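/- Setting. Consider $L_{\rm tot}\ge 1$ fermionic modes arranged in a ring, with annihilation operators $a_0,\dots,a_{L_{\rm tot}-1}$ and Fock basis $|\boldsymbol n\rangle=(a_0^\dagger)^{n_0}\cdots(a_{L_{\rm tot}-1}^\dagger)^{n_{L_{\rm tot}-1}}|\boldsymbol 0\rangle$, $\boldsymbol n\in\{0,1\}^{L_{\rm tot}}$. A mode-space unitary $u\in U(L_{\rm tot})$ acts on Fock space through the unitary $U$ (unique up to a phase) with $Ua_iU^\dagger=\sum_j u_{ij}a_j$. Let $CU_{\rm Sym}\subset U(L_{\rm tot})$ be the compact group of unitaries with $u_{i+k,j+k}=u_{ij}$ (indices modulo $L_{\rm tot}$) and $u_{ij}=u_{ji}$, with its normalised Haar measure. Let $$\mathcal M(A)=\sum_{\boldsymbol n}\mathbb E_{u\sim CU_{\rm Sym}}\langle\boldsymbol n|UAU^\dagger|\boldsymbol n\rangle\,U^\dagger|\boldsymbol n\rangle\langle\boldsymbol n|U ,$$ and let $\mathcal M^+$ be its Moore–Penrose pseudo-inverse with respect to the Hilbert–Schmidt inner product. For $k\ge 0$ let $W_{2k}$ be the span of the operators $a_{i_1}^\dagger\cdots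 a_{i_k}^\dagger a_{j_1}\cdots a_{j_k}$ on the $L_{\rm tot}$ modes, with basis $\{A_l\}$ given by those with $i_1<\dots<i_k$, $j_1<\dots<j_k$. For $O=\sum_l O_lA_l\in W_{2k}$ put $$f(O)=\sum_s\Big|\sum_l M^+_{s,l}O_l\Big| ,\qquad\text{where } \mathcal M^+(A_l)=\sum_s M^+_{s,l}A_s .$$ Let $\rho$ be a state of the first $L\le L_{\rm tot}$ modes and $\rho'=\rho\otimes|\boldsymbol 0\rangle\langle\boldsymbol 0|$ its extension by $L_{\rm tot}-L$ unoccupied auxiliary modes. Suppose that we want to estimate $\mathrm{Tr}(\rho\, a_{\boldsymbol i}^\dagger a_{\boldsymbol j})=\mathrm{Tr}(\rho\, a_{i_1}^\dagger\cdots a_{i_k}^\dagger a_{j_1}\cdots a_{j_k})$ for a non-empty set of $M_{\rm tot}$ distinct index pairs $(\boldsymbol i,\boldsymbol j)$, with $\boldsymbol i,\boldsymbol j\in\{0,\dots,L-1\}^k$, and for each of them let $O^{(\boldsymbol i,\boldsymbol j)}\in W_{2k}\cap\mathrm{Im}(\mathcal M)$ be an operator on the $L_{\rm tot}$ modes with $\mathrm{Tr}(\rho'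 O^{(\boldsymbol i,\boldsymbol j)})=\mathrm{Tr}(\rho\, a_{\boldsymbol i}^\dagger a_{\boldsymbol j})$. Let $\epsilon,\tilde\epsilon,\delta>0$ and let $N\in\mathbb N$ satisfy $$N\ge\frac{4}{\epsilon^2}\log\Big(\frac{4M_{\rm tot}}{\delta}\Big)\max_{(\boldsymbol i,\boldsymbol j)}f(O^{(\boldsymbol i,\boldsymbol j)})^2 .$$ Proposition. Let $\nu$ be a Borel probability measure on $U(L_{\rm tot})$ such that, in operator norm, $$\Big\|\mathbb E_{u\sim\nu}\big(u^{\otimes 2k}\otimes u^{*\otimes 2k}\big)-\mathbb E_{u\sim CU_{\rm Sym}}\big(u^{\otimes 2k}\otimes u^{*\otimes 2k}\big)\Big\|_\infty\; k!\,L_{\rm tot}^{3k}\max_{(\boldsymbol i,\boldsymbol j)}f(O^{(\boldsymbol i,\boldsymbol j)})\le\tilde\epsilon ,$$ where $u^*$ is the entrywise complex conjugate of $u$. Perform $N$ independent rounds: in round $m$ draw $u^{(m)}\sim\nu$, evolve $\rho'$ to $U^{(m)}\rho'U^{(m)\dagger}$, and measure the occupation numbers, with outcome $\boldsymbol n^{(m)}$.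 Then the estimates $$\hat X^{(\boldsymbol i,\boldsymbol j)}=\frac1N\sum_{m=1}^N\langle\boldsymbol n^{(m)}|U^{(m)}\mathcal M^+(O^{(\boldsymbol i,\boldsymbol j)})U^{(m)\dagger}|\boldsymbol n^{(m)}\rangle$$ satisfy, with probability at least $1-\delta$, $$\max_{(\boldsymbol i,\boldsymbol j)}\big|\hat X^{(\boldsymbol i,\boldsymbol j)}-\mathrm{Tr}(\rho\, a_{\boldsymbol i}^\dagger a_{\boldsymbol j})\big|<\epsilon+\tilde\epsilon .$$ -/

import Mathlib

open MeasureTheory ProbabilityTheory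
open scoped Matrix Kronecker ComplexConjugate ComplexOrder ComplexOrder

noncomputable section

namespace FermiShadow

/-! ### Fermionic modes and the Fock space -/

/-- Occupation numbers `(n_0, …, n_{L-1}) ∈ {0,1}^L`, labelling the Fock basis. -/
abbrev Occ (L : ℕ) : Type := Fin L → Fin 2

/-- Operators on the Fock space of `L` modes, written in the Fock basis. -/
abbrev FockOp (L : ℕ) : Type := Matrix (Occ L) (Occ L) ℂ

/-- The annihilation operator `a_j` in the Fock basis
`|n⟩ = (a_0†)^{n_0} ⋯ (a_{L-1}†)^{n_{L-1}} |0⟩`: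
`a_j |n⟩ = (-1)^{n_0 + ⋯ + n_{j-1}} |n with n_j = 0⟩` if `n_j = 1`, and `a_j |n⟩ = 0` otherwise. -/
def annihilate {L : ℕ} (j : Fin L) : FockOp L :=
  Matrix.of fun m n =>
    if n j = 1 ∧ m = Function.update n j 0 then (-1 : ℂ) ^ (∑ i with i < j, (n i : ℕ)) else 0

/-- The creation operator `a_j†`. -/
def create {L : ℕ} (j : Fin L) : FockOp L := (annihilate j)ᴴ

/-- The correlation operator `a_{i_1}† ⋯ a_{i_k}† a_{j_1} ⋯ a_{j_k}`. -/
def corrOp {L k : ℕ} (i j : Fin k → Fin L) : FockOp L :=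
  (List.ofFn fun r => create (i r)).prod * (List.ofFn fun r => annihilate (j r)).prod

/-- The space `W_{2k}` spanned by all `2k`-point correlation operators. -/
def corrSpace (L k : ℕ) : Submodule ℂ (FockOp L) :=
  Submodule.span ℂ (Set.range fun p : (Fin k → Fin L) × (Fin k → Fin L) => corrOp p.1 p.2)

/-- The labels `(i_1 < ⋯ < i_k, j_1 < ⋯ < j_k)` of the standard basis of `W_{2k}`. -/
abbrev BasisIdx (L k : ℕ) : Type :=
  {i : Fin k → Fin L // StrictMono i} × {j : Fin k → Fin L // StrictMono j}

/-- The basis operator `A_l` of `W_{2k}`. -/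
def basisOp {L k : ℕ} (l : BasisIdx L k) : FockOp L := corrOp l.1.1 l.2.1

open Classical in
/-- The coefficients `O_l` in the expansion `O = ∑_l O_l A_l` of an operator `O ∈ W_{2k}` in the
basis `A_l`. (The value `0` is used for operators outside `W_{2k}`.) -/
def coeff {L : ℕ} (k : ℕ) (O : FockOp L) : BasisIdx L k → ℂ :=
  if h : ∃ c : BasisIdx L k → ℂ, O = ∑ l, c l • basisOp l then h.choose else 0

/-- A density matrix on the Fock space. -/
structure IsState {L : ℕ} (ρ : FockOp L) : Prop where
  posSemidef : ρ.PosSemidef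
  trace_eq_one : ρ.trace = 1

/-- The state `ρ ⊗ |0⟩⟨0|` on `Ltot ≥ L` modes: modes `0, …, L-1` carry `ρ`, the auxiliary modes
`L, …, Ltot-1` are unoccupied. -/
def extendState {L Ltot : ℕ} (h : L ≤ Ltot) (ρ : FockOp L) : FockOp Ltot :=
  Matrix.of fun m n =>
    if (∀ i : Fin Ltot, L ≤ (i : ℕ) → m i = 0) ∧ (∀ i : Fin Ltot, L ≤ (i : ℕ) → n i = 0) then
      ρ (fun i => m (Fin.castLE h i)) (fun i => n (Fin.castLE h i))
    else 0

/-! ### Mode-space unitaries and their action on the Fock space -/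

/-- The unitary group `U(L)` of the mode space. -/
abbrev UL (L : ℕ) : Type := Matrix.unitaryGroup (Fin L) ℂ

instance (L : ℕ) : MeasurableSpace (UL L) := borel _

instance (L : ℕ) : BorelSpace (UL L) := ⟨rfl⟩

/-- The free, particle number preserving unitary `U` on the Fock space with
`U a_i U† = ∑_j u_{ij} a_j` and `U |0⟩ = |0⟩`, given on the Fock basis by
`U |n⟩ = (b_0†)^{n_0} ⋯ (b_{L-1}†)^{n_{L-1}} |0⟩`, where `b_i† = ∑_j conj(u_{ij}) a_j†`. -/
def fockUnitary {L : ℕ} (u : UL L) : FockOp L :=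
  Matrix.of fun m n =>
    (List.ofFn fun i : Fin L =>
      (∑ j, conj ((u : Matrix (Fin L) (Fin L) ℂ) i j) • create j) ^ (n i : ℕ)).prod m 0

theorem continuous_fockUnitary {L : ℕ} : Continuous (fockUnitary : UL L → FockOp L) := by
  refine continuous_matrix fun m n => ?_
  refine Continuous.matrix_elem (A := fun u : UL L => (List.ofFn fun i : Fin L =>
      (∑ j, conj ((u : Matrix (Fin L) (Fin L) ℂ) i j) • create j) ^ (n i : ℕ)).prod) ?_ m 0
  simp only [List.ofFn_eq_map]
  refine continuous_list_prod _ fun i _ => ?_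
  refine Continuous.pow ?_ _
  refine continuous_finsetSum _ fun j _ => ?_
  refine Continuous.smul (f := fun u : UL L => conj ((u : Matrix (Fin L) (Fin L) ℂ) i j)) ?_
    continuous_const
  exact Complex.continuous_conj.comp (continuous_subtype_val.matrix_elem i j)

theorem isCompact_unitary (L : ℕ) :
    IsCompact (Matrix.unitaryGroup (Fin L) ℂ : Set (Matrix (Fin L) (Fin L) ℂ)) := by
  have hK : IsCompact (Set.pi Set.univ fun _ : Fin L => Set.pi Set.univ fun _ : Fin L =>
      Metric.closedBall (0 : ℂ) 1) :=
    isCompact_univ_pi fun _ => isCompact_univ_pi fun _ => isCompact_closedBall _ _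
  refine IsCompact.of_isClosed_subset (s := (Set.pi Set.univ fun _ : Fin L =>
    Set.pi Set.univ fun _ : Fin L => Metric.closedBall (0 : ℂ) 1 :
      Set (Matrix (Fin L) (Fin L) ℂ))) hK ?_ ?_
  · have : (Matrix.unitaryGroup (Fin L) ℂ : Set (Matrix (Fin L) (Fin L) ℂ)) =
        {A | A * star A = 1} := by
      ext A
      simp [Matrix.mem_unitaryGroup_iff]
    rw [this]
    exact isClosed_eq (continuous_id.mul continuous_id.matrix_conjTranspose) continuous_const
  · intro A hA i _ j _
    simpa using entry_norm_bound_of_unitary hA i j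

instance (L : ℕ) : CompactSpace (UL L) := isCompact_iff_compactSpace.mp (isCompact_unitary L)

/-- The group `CU_Sym(L)` of symmetric circulant unitaries; indices are taken modulo `L`. -/
def CUSym (L : ℕ) [NeZero L] : Subgroup (UL L) where
  carrier := {u | (∀ i j k : Fin L, u.1 (i + k) (j + k) = u.1 i j) ∧
    ∀ i j : Fin L, u.1 i j = u.1 j i}
  one_mem' := by
    refine ⟨fun i j k => ?_, fun i j => ?_⟩
    · simp [Matrix.one_apply]
    · simp [Matrix.one_apply, eq_comm]
  mul_mem' := by
    rintro u v ⟨hu, hu'⟩ ⟨hv, hv'⟩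
    refine ⟨fun i j k => ?_, fun i j => ?_⟩
    · simp only [Submonoid.coe_mul, Matrix.mul_apply]
      conv_lhs => rw [← Equiv.sum_comp (Equiv.addRight k)]
      simp only [Equiv.coe_addRight, hu, hv]
    · simp only [Submonoid.coe_mul, Matrix.mul_apply]
      conv_lhs => rw [← Equiv.sum_comp (Equiv.subLeft (i + j))]
      refine Finset.sum_congr rfl fun l _ => ?_
      simp only [Equiv.subLeft_apply]
      have h1 : u.1 i (i + j - l) = u.1 l j := by
        have := hu i (i + j - l) (l - i)
        have e1 : i + (l - i) = l := by abel
        have e2 : i + j - l + (l - i) = j := by abel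
        rw [← this, e1, e2]
      have h2 : v.1 (i + j - l) j = v.1 i l := by
        have := hv (i + j - l) j (l - j)
        have e1 : i + j - l + (l - j) = i := by abel
        have e2 : j + (l - j) = l := by abel
        rw [← this, e1, e2]
      rw [h1, h2, hu' l j, hv' i l]
  inv_mem' := by
    rintro u ⟨hu, hu'⟩
    have h : ∀ i j, (u⁻¹).1 i j = conj (u.1 j i) := fun i j => rfl
    exact ⟨fun i j k => by rw [h, h, hu], fun i j => by rw [h, h, hu']⟩

theorem isClosed_CUSym (L : ℕ) [NeZero L] : IsClosed (CUSym L : Set (UL L)) := by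
  have e : ∀ i j : Fin L, Continuous fun u : UL L => u.1 i j :=
    fun i j => continuous_subtype_val.matrix_elem i j
  have : (CUSym L : Set (UL L)) =
      (⋂ i, ⋂ j, ⋂ k, {u : UL L | u.1 (i + k) (j + k) = u.1 i j}) ∩
        ⋂ i, ⋂ j, {u : UL L | u.1 i j = u.1 j i} := by
    ext u
    simp [CUSym]
  rw [this]
  refine IsClosed.inter ?_ ?_
  · exact isClosed_iInter fun i => isClosed_iInter fun j => isClosed_iInter fun k =>
      isClosed_eq (e _ _) (e _ _)
  · exact isClosed_iInter fun i => isClosed_iInter fun j => isClosed_eq (e _ _) (e _ _)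

instance (L : ℕ) [NeZero L] : CompactSpace (CUSym L) :=
  isCompact_iff_compactSpace.mp (isClosed_CUSym L).isCompact

/-- The normalised Haar measure of the compact group `CU_Sym(L)`. -/
def haarCUSym (L : ℕ) [NeZero L] : Measure (CUSym L) := Measure.haarMeasure ⊤

instance (L : ℕ) [NeZero L] : IsProbabilityMeasure (haarCUSym L) := by
  refine ⟨?_⟩
  have := Measure.haarMeasure_self (G := CUSym L) (K₀ := ⊤)
  simpa [haarCUSym] using this

/-- The ensemble "`u` uniform in `CU_Sym(L)`", as a probability measure on `U(L)`. -/
def symEnsemble (L : ℕ) [NeZero L] : Measure (UL L) := (haarCUSym L).map Subtype.val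

instance (L : ℕ) [NeZero L] : IsProbabilityMeasure (symEnsemble L) :=
  Measure.isProbabilityMeasure_map measurable_subtype_coe.aemeasurable

/-! ### Moment operators -/

/-- The tensor power `u^{⊗t}`. -/
def tensorPow {L : ℕ} (t : ℕ) (u : Matrix (Fin L) (Fin L) ℂ) :
    Matrix (Fin t → Fin L) (Fin t → Fin L) ℂ :=
  Matrix.of fun x y => ∏ a, u (x a) (y a)

/-- The `t`-th moment `𝔼_{u ∼ ν} (u^{⊗t} ⊗ (u^*)^{⊗t})`, with `u^*` the entrywise conjugate. -/
def momentOp {L : ℕ} (t : ℕ) (ν : Measure (UL L)) :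
    Matrix ((Fin t → Fin L) × (Fin t → Fin L)) ((Fin t → Fin L) × (Fin t → Fin L)) ℂ :=
  Matrix.of fun x y =>
    ∫ u : UL L, (tensorPow t u.1 ⊗ₖ tensorPow t (u.1.map conj)) x y ∂ν

/-- The operator norm of a matrix (its largest singular value). -/
def opNorm {ι : Type*} [Fintype ι] [DecidableEq ι] (A : Matrix ι ι ℂ) : ℝ :=
  ‖Matrix.toEuclideanCLM (n := ι) (𝕜 := ℂ) A‖

/-! ### The measurement channel and its pseudo-inverse -/

/-- `⟨n| U A U† |n⟩`, where `U` is the Fock space unitary of `u`. -/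
def diagEntry {L : ℕ} (u : UL L) (A : FockOp L) (n : Occ L) : ℂ :=
  (fockUnitary u * A * (fockUnitary u)ᴴ) n n

/-- The operator `∑_n ⟨n| U A U† |n⟩ U† |n⟩⟨n| U`. -/
def channelIntegrand {L : ℕ} (u : UL L) (A : FockOp L) : FockOp L :=
  ∑ n : Occ L, diagEntry u A n • ((fockUnitary u)ᴴ * Matrix.single n n 1 * fockUnitary u)

theorem continuous_channelIntegrand {L : ℕ} (A : FockOp L) :
    Continuous fun u : UL L => channelIntegrand u A := by
  have h : Continuous (fockUnitary : UL L → FockOp L) := continuous_fockUnitary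
  refine continuous_finsetSum _ fun n _ =>
    Continuous.smul (f := fun u : UL L => diagEntry u A n)
      (g := fun u : UL L => (fockUnitary u)ᴴ * Matrix.single n n 1 * fockUnitary u) ?_ ?_
  · exact ((h.mul continuous_const).mul h.matrix_conjTranspose).matrix_elem n n
  · exact (h.matrix_conjTranspose.mul continuous_const).mul h

theorem integrable_channelIntegrand {L : ℕ} (ν : Measure (UL L)) [IsFiniteMeasure ν]
    (A : FockOp L) (p q : Occ L) : Integrable (fun u : UL L => channelIntegrand u A p q) ν :=
  ((continuous_channelIntegrand A).matrix_elem p q).integrable_of_hasCompactSupport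
    (HasCompactSupport.of_compactSpace _)

/-- The measurement channel `ℳ(A) = ∑_n 𝔼_{u ∼ ν} ⟨n| U A U† |n⟩ U† |n⟩⟨n| U`. -/
def measurementChannel {L : ℕ} (ν : Measure (UL L)) [IsFiniteMeasure ν] :
    FockOp L →ₗ[ℂ] FockOp L where
  toFun A := Matrix.of fun p q => ∫ u : UL L, channelIntegrand u A p q ∂ν
  map_add' A B := by
    ext p q
    have : ∀ u : UL L, channelIntegrand u (A + B) p q =
        channelIntegrand u A p q + channelIntegrand u B p q := fun u => by
      simp [channelIntegrand, diagEntry, mul_add, add_mul, add_smul, Finset.sum_add_distrib]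
    simp only [Matrix.of_apply, Matrix.add_apply, this]
    exact integral_add (integrable_channelIntegrand ν A p q) (integrable_channelIntegrand ν B p q)
  map_smul' c A := by
    ext p q
    have : ∀ u : UL L, channelIntegrand u (c • A) p q = c * channelIntegrand u A p q := fun u => by
      simp [channelIntegrand, diagEntry, Matrix.sum_apply, Finset.mul_sum, mul_assoc]
    simp only [Matrix.of_apply, Matrix.smul_apply, this, RingHom.id_apply, smul_eq_mul]
    exact integral_const_mul c _

/-- `P` is the Moore–Penrose pseudo-inverse of `M` with respect to the Hilbert–Schmidt inner
product `⟨A, B⟩ = Tr(A† B)` on matrices. -/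
structure IsMoorePenrose {n : Type*} [Fintype n]
    (M P : Matrix n n ℂ →ₗ[ℂ] Matrix n n ℂ) : Prop where
  mul_mul_self : ∀ A, M (P (M A)) = M A
  inv_mul_inv : ∀ A, P (M (P A)) = P A
  selfAdjoint_left : ∀ A B, ((M (P A))ᴴ * B).trace = (Aᴴ * M (P B)).trace
  selfAdjoint_right : ∀ A B, ((P (M A))ᴴ * B).trace = (Aᴴ * P (M B)).trace

theorem exists_pinv_inner {E : Type*} [NormedAddCommGroup E] [InnerProductSpace ℂ E]
    [FiniteDimensional ℂ E] (T : E →ₗ[ℂ] E) : ∃ P : E →ₗ[ℂ] E,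
      (∀ x, T (P (T x)) = T x) ∧ (∀ x, P (T (P x)) = P x) ∧
      (∀ x y, inner ℂ (T (P x)) y = inner ℂ x (T (P y))) ∧
      (∀ x y, inner ℂ (P (T x)) y = inner ℂ x (P (T y))) := by
  have hker : ∀ x, T ((LinearMap.ker T)ᗮ.starProjection x) = T x := fun x => by
    have h := (LinearMap.ker T)ᗮ.sub_starProjection_mem_orthogonal x
    rw [Submodule.orthogonal_orthogonal, LinearMap.mem_ker, map_sub, sub_eq_zero] at h
    exact h.symm
  let g : (LinearMap.ker T)ᗮ →ₗ[ℂ] LinearMap.range T :=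
    T.rangeRestrict.comp (LinearMap.ker T)ᗮ.subtype
  have hg : Function.Bijective g := by
    refine ⟨?_, ?_⟩
    · rw [← LinearMap.ker_eq_bot, LinearMap.ker_eq_bot']
      intro x hx
      have h1 : T x = 0 := congrArg Subtype.val hx
      exact Subtype.ext ((Submodule.orthogonal_disjoint _).le_bot ⟨h1, x.2⟩)
    · rintro ⟨_, x, rfl⟩
      exact ⟨⟨_, Submodule.starProjection_apply_mem _ x⟩, Subtype.ext (hker x)⟩
  let e := LinearEquiv.ofBijective g hg
  let P : E →ₗ[ℂ] E := (LinearMap.ker T)ᗮ.subtype ∘ₗ e.symm.toLinearMap ∘ₗ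
    (LinearMap.range T).orthogonalProjectionOnto.toLinearMap
  have hTP : ∀ x, T (P x) = (LinearMap.range T).starProjection x := fun x => by
    exact congrArg Subtype.val (e.apply_symm_apply ((LinearMap.range T).orthogonalProjectionOnto x))
  have hPT : ∀ x, P (T x) = (LinearMap.ker T)ᗮ.starProjection x := fun x => by
    have h1 : (LinearMap.range T).orthogonalProjectionOnto (T x) =
        e ⟨_, Submodule.starProjection_apply_mem _ x⟩ := by
      refine Subtype.ext ?_
      have : (T x) ∈ LinearMap.range T := ⟨x, rfl⟩
      exact (Submodule.starProjection_eq_self_iff.mpr this).trans (hker x).symm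
    change ((e.symm ((LinearMap.range T).orthogonalProjectionOnto (T x)) : (LinearMap.ker T)ᗮ) : E) = _
    rw [h1, LinearEquiv.symm_apply_apply]
  refine ⟨P, fun x => ?_, fun x => ?_, fun x y => ?_, fun x y => ?_⟩
  · rw [hPT, hker]
  · rw [hPT]
    exact Submodule.starProjection_eq_self_iff.mpr (Subtype.prop _)
  · rw [hTP, hTP]
    exact Submodule.inner_starProjection_left_eq_right _ x y
  · rw [hPT, hPT]
    exact Submodule.inner_starProjection_left_eq_right _ x y

theorem exists_isMoorePenrose {n : Type*} [Fintype n]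
    (M : Matrix n n ℂ →ₗ[ℂ] Matrix n n ℂ) : ∃ P, IsMoorePenrose M P := by
  let ψ : Matrix n n ℂ ≃ₗ[ℂ] EuclideanSpace ℂ (n × n) :=
    (LinearEquiv.curry ℂ ℂ n n).symm.trans (WithLp.linearEquiv 2 ℂ (n × n → ℂ)).symm
  have hψ : ∀ A B, (Aᴴ * B).trace = inner ℂ (ψ A) (ψ B) := fun A B => by
    simp only [Matrix.trace, Matrix.diag, Matrix.mul_apply, Matrix.conjTranspose_apply,
      PiLp.inner_apply, Fintype.sum_prod_type]
    rw [Finset.sum_comm]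
    refine Finset.sum_congr rfl fun i _ => Finset.sum_congr rfl fun j _ => ?_
    exact mul_comm _ _
  obtain ⟨P, h1, h2, h3, h4⟩ :=
    exists_pinv_inner (ψ.toLinearMap ∘ₗ M ∘ₗ ψ.symm.toLinearMap)
  refine ⟨ψ.symm.toLinearMap ∘ₗ P ∘ₗ ψ.toLinearMap, fun A => ?_, fun A => ?_, fun A B => ?_,
    fun A B => ?_⟩
  · simpa using h1 (ψ A)
  · simpa using h2 (ψ A)
  · simpa [hψ] using h3 (ψ A) (ψ B)
  · simpa [hψ] using h4 (ψ A) (ψ B)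

/-- The Moore–Penrose pseudo-inverse `M⁺` with respect to the Hilbert–Schmidt inner product. -/
def pinv {n : Type*} [Fintype n] (M : Matrix n n ℂ →ₗ[ℂ] Matrix n n ℂ) :
    Matrix n n ℂ →ₗ[ℂ] Matrix n n ℂ :=
  (exists_isMoorePenrose M).choose

/-- The measurement channel `ℳ` of the ensemble of Haar random symmetric circulant unitaries. -/
def symChannel (L : ℕ) [NeZero L] : FockOp L →ₗ[ℂ] FockOp L := measurementChannel (symEnsemble L)

/-! ### The estimation protocol -/

/-- `f(O) = ∑_s |∑_l M⁺_{s,l} O_l|`, where `M⁺_{s,l}` are the matrix elements of `ℳ⁺` in the basis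
`A_l` of `W_{2k}`, i.e. `ℳ⁺(A_l) = ∑_s M⁺_{s,l} A_s`, and `O = ∑_l O_l A_l`. -/
def fBound {L : ℕ} [NeZero L] (k : ℕ) (O : FockOp L) : ℝ :=
  ∑ s : BasisIdx L k,
    ‖∑ l : BasisIdx L k, coeff k (pinv (symChannel L) (basisOp l)) s * coeff k O l‖

/-- The joint law of one measurement round `(u, n)` on the state `ρ`: `u` is drawn from `ν`, and
given `u` the outcome of the occupation number measurement of `U ρ U†` is `n` with probability
`⟨n| U ρ U† |n⟩`. -/
def roundLaw {L : ℕ} (ν : Measure (UL L)) (ρ : FockOp L) : Measure (UL L × Occ L) :=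
  ∑ n : Occ L,
    (ν.withDensity fun u => ENNReal.ofReal (diagEntry u ρ n).re).map fun u => (u, n)

/-- The single-round estimate `X_{u,n} = ⟨n| U ℳ⁺(O) U† |n⟩`, where `ℳ` is the channel of the Haar
ensemble on `CU_Sym(L)`. -/
def singleShot {L : ℕ} [NeZero L] (O : FockOp L) (z : UL L × Occ L) : ℂ :=
  diagEntry z.1 (pinv (symChannel L) O) z.2

/-- The arithmetic mean `(1/N) ∑_m X_{u^(m), n^(m)}` of `N` single-round estimates. -/
def meanEstimate {L : ℕ} [NeZero L] {N : ℕ} (O : FockOp L) (z : Fin N → UL L × Occ L) : ℂ :=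
  (1 / (N : ℂ)) * ∑ m, singleShot O (z m)

/-- `O`, a `2k`-point operator on `Ltot ≥ L` modes, can be used to form the unbiased estimator of
`Tr(ρ a_{i_1}† ⋯ a_{i_k}† a_{j_1} ⋯ a_{j_k})`: it lies in the image of `ℳ`, and has the desired
expectation value in the state `ρ ⊗ |0⟩⟨0|`. -/
structure IsRecoveryOp {L Ltot k : ℕ} [NeZero Ltot] (h : L ≤ Ltot) (ρ : FockOp L)
    (i j : Fin k → Fin L) (O : FockOp Ltot) : Prop where
  mem_corrSpace : O ∈ corrSpace Ltot k
  mem_range : O ∈ LinearMap.range (symChannel Ltot)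
  trace_eq : (extendState h ρ * O).trace = (ρ * corrOp i j).trace

end FermiShadow

end

open MeasureTheory ProbabilityTheory
open scoped Matrix Kronecker ComplexConjugate ComplexOrder

noncomputable section

namespace FermiShadow

/-! ### Canonical anticommutation relations -/

/-- The Jordan–Wigner sign `(-1)^{n_0 + ⋯ + n_{j-1}}`. -/
def jwSign {L : ℕ} (j : Fin L) (n : Occ L) : ℂ := (-1) ^ (∑ i with i < j, (n i : ℕ))

theorem jwSign_mul_self {L : ℕ} (j : Fin L) (n : Occ L) : jwSign j n * jwSign j n = 1 := by
  rw [jwSign, ← pow_add, ← two_mul, pow_mul]; simp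

theorem jwSign_update_of_not_lt {L : ℕ} {i j : Fin L} (h : ¬ j < i) (n : Occ L) (b : Fin 2) :
    jwSign i (Function.update n j b) = jwSign i n := by
  unfold jwSign
  congr 1
  refine Finset.sum_congr rfl fun l hl => ?_
  rw [Function.update_of_ne]
  rintro rfl
  exact h (by simpa using hl)

theorem jwSign_update_of_lt {L : ℕ} {i j : Fin L} (h : j < i) (n : Occ L) (b : Fin 2) :
    jwSign i (Function.update n j b) = (-1) ^ ((b : ℕ) + (n j : ℕ)) * jwSign i n := by
  unfold jwSign
  have hj : j ∈ Finset.univ.filter (· < i) := by simpa using h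
  rw [← Finset.add_sum_erase _ _ hj, ← Finset.add_sum_erase _ (fun l => (n l : ℕ)) hj,
    Function.update_self, ← pow_add]
  have : ∑ x ∈ (Finset.univ.filter (· < i)).erase j, ((Function.update n j b x : Fin 2) : ℕ) =
      ∑ x ∈ (Finset.univ.filter (· < i)).erase j, (n x : ℕ) :=
    Finset.sum_congr rfl fun l hl => by rw [Function.update_of_ne (Finset.ne_of_mem_erase hl)]
  rw [this]
  have e : (b : ℕ) + (n j : ℕ) + ((n j : ℕ) +
      ∑ x ∈ (Finset.univ.filter (· < i)).erase j, (n x : ℕ)) =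
      ((b : ℕ) + ∑ x ∈ (Finset.univ.filter (· < i)).erase j, (n x : ℕ)) + 2 * (n j : ℕ) := by ring
  rw [e, pow_add _ _ (2 * _), pow_mul]; simp

theorem fin_two_ne_zero {b : Fin 2} : b ≠ 0 ↔ b = 1 := by omega

theorem annihilate_mulVec {L : ℕ} (j : Fin L) (v : Occ L → ℂ) (m : Occ L) :
    (annihilate j *ᵥ v) m =
      if m j = 0 then jwSign j m * v (Function.update m j 1) else 0 := by
  simp only [Matrix.mulVec, dotProduct, annihilate, Matrix.of_apply, ite_mul, zero_mul]
  split_ifs with h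
  · rw [Finset.sum_eq_single (Function.update m j 1)]
    · rw [if_pos]
      · rw [← jwSign_update_of_not_lt (lt_irrefl j) m 1]; rfl
      · simp [← h]
    · intro n _ hn
      rw [if_neg]
      rintro ⟨h1, h2⟩
      exact hn (by rw [h2, ← h1]; simp)
    · simp
  · refine Finset.sum_eq_zero fun n _ => if_neg ?_
    rintro ⟨-, rfl⟩
    simp at h

theorem create_mulVec {L : ℕ} (j : Fin L) (v : Occ L → ℂ) (m : Occ L) :
    (create j *ᵥ v) m =
      if m j = 1 then jwSign j m * v (Function.update m j 0) else 0 := by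
  simp only [Matrix.mulVec, dotProduct, create, annihilate, Matrix.conjTranspose_apply,
    Matrix.of_apply]
  split_ifs with h
  · rw [Finset.sum_eq_single (Function.update m j 0)]
    · simp [h, jwSign]
    · intro n _ hn
      rw [if_neg (fun h => hn h.2)]
      simp
    · simp
  · simp [h]

theorem annihilate_anticomm {L : ℕ} (i j : Fin L) :
    (annihilate i * annihilate j + annihilate j * annihilate i : FockOp L) = 0 := by
  refine Matrix.ext_of_mulVec_single fun n => ?_
  generalize (Pi.single n 1 : Occ L → ℂ) = v
  ext m
  rw [Matrix.add_mulVec, ← Matrix.mulVec_mulVec, ← Matrix.mulVec_mulVec, Pi.add_apply,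
    Matrix.zero_mulVec, Pi.zero_apply]
  simp only [annihilate_mulVec]
  rcases lt_trichotomy i j with h | rfl | h
  · rw [Function.update_of_ne h.ne', Function.update_of_ne h.ne, Function.update_comm h.ne,
      jwSign_update_of_lt h, jwSign_update_of_not_lt h.not_gt]
    split_ifs with h1 h2 <;> simp [*] ; ring
  · simp
  · rw [Function.update_of_ne h.ne', Function.update_of_ne h.ne, Function.update_comm h.ne,
      jwSign_update_of_lt h, jwSign_update_of_not_lt h.not_gt]
    split_ifs with h1 h2 <;> simp [*] ; ring

theorem annihilate_create {L : ℕ} (i j : Fin L) :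
    (annihilate i * create j + create j * annihilate i : FockOp L) =
      (1 : Matrix (Fin L) (Fin L) ℂ) i j • 1 := by
  refine Matrix.ext_of_mulVec_single fun n => ?_
  generalize (Pi.single n 1 : Occ L → ℂ) = v
  ext m
  rw [Matrix.add_mulVec, ← Matrix.mulVec_mulVec, ← Matrix.mulVec_mulVec, Pi.add_apply,
    Matrix.smul_mulVec, Matrix.one_mulVec, Pi.smul_apply]
  simp only [annihilate_mulVec, create_mulVec]
  rcases lt_trichotomy i j with h | rfl | h
  · rw [Function.update_of_ne h.ne', Function.update_of_ne h.ne, Function.update_comm h.ne,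
      jwSign_update_of_lt h, jwSign_update_of_not_lt h.not_gt, Matrix.one_apply_ne h.ne]
    split_ifs with h1 h2 <;> simp [*] ; ring
  · have e0 := jwSign_update_of_not_lt (lt_irrefl i) m 0
    have e1 := jwSign_update_of_not_lt (lt_irrefl i) m 1
    rcases eq_or_ne (m i) 0 with h | h
    · have : Function.update m i 0 = m := by rw [← h]; simp
      simp [h, e1, this, ← mul_assoc, jwSign_mul_self]
    · rw [fin_two_ne_zero] at h
      have : Function.update m i 1 = m := by rw [← h]; simp
      simp [h, e0, this, ← mul_assoc, jwSign_mul_self]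
  · rw [Function.update_of_ne h.ne', Function.update_of_ne h.ne, Function.update_comm h.ne,
      jwSign_update_of_lt h, jwSign_update_of_not_lt h.not_gt, Matrix.one_apply_ne h.ne']
    split_ifs with h1 h2 <;> simp [*] ; ring

theorem create_anticomm {L : ℕ} (i j : Fin L) :
    (create i * create j + create j * create i : FockOp L) = 0 := by
  have := congrArg Matrix.conjTranspose (annihilate_anticomm j i)
  simpa [create, Matrix.conjTranspose_mul] using this

theorem conjTranspose_create {L : ℕ} (j : Fin L) : (create j : FockOp L)ᴴ = annihilate j := by
  simp [create]

/-! ### The vacuum generates the Fock space -/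

/-- The vacuum vector. -/
def vac (L : ℕ) : Occ L → ℂ := Pi.single 0 1

theorem annihilate_vac {L : ℕ} (j : Fin L) : annihilate j *ᵥ vac L = 0 := by
  ext m
  rw [annihilate_mulVec, Pi.zero_apply]
  split_ifs with h
  · rw [vac, Pi.single_eq_of_ne, mul_zero]
    intro h'
    simpa using congrFun h' j
  · rfl

theorem create_mulVec_single {L : ℕ} (j : Fin L) (n : Occ L) :
    create j *ᵥ Pi.single n (1 : ℂ) =
      if n j = 0 then jwSign j n • Pi.single (Function.update n j 1) (1 : ℂ) else 0 := by
  ext m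
  rw [create_mulVec]
  simp only [Pi.single_apply]
  by_cases hn : n j = 0
  · rw [if_pos hn]
    simp only [Pi.smul_apply, smul_eq_mul, Pi.single_apply]
    by_cases h : m = Function.update n j 1
    · subst h
      have e : Function.update n j 0 = n := by rw [← hn]; simp
      simp [e, jwSign_update_of_not_lt]
    · rw [if_neg h]
      split_ifs with h1 h2
      · exact absurd (by rw [← h2, ← h1]; simp) h
      · simp
      · simp
  · rw [if_neg hn, Pi.zero_apply]
    split_ifs with h1 h2
    · exact absurd (by rw [← h2]; simp) hn
    · simp
    · rfl

theorem eq_top_of_vac_mem {L : ℕ} (S : Submodule ℂ (Occ L → ℂ)) (h0 : vac L ∈ S)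
    (hS : ∀ j, ∀ v ∈ S, create j *ᵥ v ∈ S) : S = ⊤ := by
  have key : ∀ (d : ℕ) (n : Occ L), ∑ i, (n i : ℕ) = d → (Pi.single n (1 : ℂ)) ∈ S := by
    intro d
    induction d with
    | zero =>
      intro n hn
      have : n = 0 := by
        ext i
        simpa using Finset.sum_eq_zero_iff.mp hn i (Finset.mem_univ i)
      subst this
      exact h0
    | succ d ih =>
      intro n hn
      obtain ⟨j, hj⟩ : ∃ j, n j ≠ 0 := by
        by_contra! h
        simp [h] at hn
      rw [fin_two_ne_zero] at hj
      have hd : ∑ i, ((Function.update n j 0 i : Fin 2) : ℕ) = d := by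
        rw [← Finset.add_sum_erase _ _ (Finset.mem_univ j)] at hn ⊢
        rw [Finset.sum_congr rfl fun i hi => by
          rw [Function.update_of_ne (Finset.ne_of_mem_erase hi)]]
        simp [hj] at hn ⊢
        omega
      have := hS j _ (ih _ hd)
      rw [create_mulVec_single, if_pos (by simp)] at this
      have h2 := S.smul_mem (jwSign j (Function.update n j 0)) this
      rw [smul_smul, jwSign_mul_self, one_smul, Function.update_idem, ← hj,
        Function.update_eq_self] at h2
      exact h2
  refine eq_top_iff.mpr fun v _ => ?_
  rw [← Finset.univ_sum_single v]
  refine S.sum_mem fun n _ => ?_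
  have := S.smul_mem (v n) (key _ n rfl)
  rwa [← Pi.single_smul, smul_eq_mul, mul_one] at this

theorem ext_of_vac {L : ℕ} {A B : FockOp L} (h0 : A *ᵥ vac L = B *ᵥ vac L)
    (hS : ∀ j v, A *ᵥ v = B *ᵥ v → A *ᵥ (create j *ᵥ v) = B *ᵥ (create j *ᵥ v)) : A = B := by
  have h := eq_top_of_vac_mem (LinearMap.eqLocus A.mulVecLin B.mulVecLin) h0 hS
  refine Matrix.ext_of_mulVec_single fun n => ?_
  have : (Pi.single n 1 : Occ L → ℂ) ∈ LinearMap.eqLocus A.mulVecLin B.mulVecLin := by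
    rw [h]; trivial
  exact this

/-! ### The Fock space unitary intertwines the rotated modes -/

/-- The rotated annihilation operator `∑_j u_{ij} a_j`. -/
def rotAnnihilate {L : ℕ} (u : UL L) (i : Fin L) : FockOp L := ∑ j, u.1 i j • annihilate j

/-- The rotated creation operator `∑_j conj(u_{ij}) a_j†`. -/
def rotCreate {L : ℕ} (u : UL L) (i : Fin L) : FockOp L := ∑ j, conj (u.1 i j) • create j

theorem conjTranspose_rotCreate {L : ℕ} (u : UL L) (i : Fin L) :
    (rotCreate u i)ᴴ = rotAnnihilate u i := by
  simp [rotCreate, rotAnnihilate, Matrix.conjTranspose_sum, conjTranspose_create]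

theorem rotCreate_anticomm {L : ℕ} (u : UL L) (i j : Fin L) :
    rotCreate u i * rotCreate u j + rotCreate u j * rotCreate u i = 0 := by
  simp only [rotCreate, Finset.sum_mul_sum]
  rw [Finset.sum_comm (s := Finset.univ) (t := Finset.univ)
    (f := fun a b => (conj (u.1 j a) • (create a : FockOp L)) * (conj (u.1 i b) • create b)),
    ← Finset.sum_add_distrib]
  refine Finset.sum_eq_zero fun a _ => ?_
  rw [← Finset.sum_add_distrib]
  refine Finset.sum_eq_zero fun b _ => ?_
  rw [smul_mul_smul_comm, smul_mul_smul_comm, mul_comm (conj (u.1 j b)), ← smul_add,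
    create_anticomm, smul_zero]

theorem sum_mul_conj {L : ℕ} (u : UL L) (i j : Fin L) :
    ∑ l, u.1 i l * conj (u.1 j l) = (1 : Matrix (Fin L) (Fin L) ℂ) i j := by
  have h : u.1 * star u.1 = 1 := Matrix.mem_unitaryGroup_iff.mp u.2
  rw [← h, Matrix.mul_apply]
  rfl

theorem sum_conj_mul {L : ℕ} (u : UL L) (i j : Fin L) :
    ∑ l, conj (u.1 l i) * u.1 l j = (1 : Matrix (Fin L) (Fin L) ℂ) i j := by
  have h : star u.1 * u.1 = 1 := Matrix.mem_unitaryGroup_iff'.mp u.2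
  rw [← h, Matrix.mul_apply]
  rfl

theorem rotAnnihilate_rotCreate {L : ℕ} (u : UL L) (i j : Fin L) :
    rotAnnihilate u i * rotCreate u j + rotCreate u j * rotAnnihilate u i =
      (1 : Matrix (Fin L) (Fin L) ℂ) i j • 1 := by
  simp only [rotCreate, rotAnnihilate, Finset.sum_mul_sum]
  rw [Finset.sum_comm (s := Finset.univ) (t := Finset.univ)
    (f := fun a b => (conj (u.1 j a) • (create a : FockOp L)) * (u.1 i b • annihilate b)),
    ← Finset.sum_add_distrib, ← sum_mul_conj u i j, Finset.sum_smul]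
  refine Finset.sum_congr rfl fun a _ => ?_
  rw [← Finset.sum_add_distrib]
  have : ∀ b, u.1 i a • annihilate a * conj (u.1 j b) • create b +
      conj (u.1 j b) • create b * u.1 i a • annihilate a =
      (u.1 i a * conj (u.1 j b) * (1 : Matrix (Fin L) (Fin L) ℂ) a b) • (1 : FockOp L) := by
    intro b
    rw [smul_mul_smul_comm, smul_mul_smul_comm, mul_comm (conj (u.1 j b)), ← smul_add,
      annihilate_create, smul_smul]
  rw [Finset.sum_congr rfl fun b _ => this b, Finset.sum_eq_single a]
  · simp
  · intro b _ hb
    simp [Matrix.one_apply_ne hb.symm]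
  · simp

theorem rotAnnihilate_vac {L : ℕ} (u : UL L) (i : Fin L) : rotAnnihilate u i *ᵥ vac L = 0 := by
  simp [rotAnnihilate, Matrix.sum_mulVec, Matrix.smul_mulVec, annihilate_vac]

theorem create_eq_sum_rotCreate {L : ℕ} (u : UL L) (l : Fin L) :
    create l = ∑ i, u.1 i l • rotCreate u i := by
  simp only [rotCreate, Finset.smul_sum, smul_smul]
  rw [Finset.sum_comm]
  simp only [← Finset.sum_smul]
  have : ∀ j, ∑ i, u.1 i l * conj (u.1 i j) = (1 : Matrix (Fin L) (Fin L) ℂ) j l := fun j => by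
    rw [← sum_conj_mul u]
    exact Finset.sum_congr rfl fun _ _ => mul_comm _ _
  simp [this, Matrix.one_apply]

/-- Multiplying an ordered monomial in anticommuting square-zero elements by one of them. -/
theorem mul_prod_ofFn_pow {R : Type*} [Ring R] [Algebra ℂ R] : ∀ {L : ℕ} (c : Fin L → R)
    (_ : ∀ i j, c i * c j + c j * c i = 0) (n : Occ L) (i : Fin L),
    c i * (List.ofFn fun j => c j ^ (n j : ℕ)).prod =
      if n i = 0 then
        jwSign i n • (List.ofFn fun j => c j ^ ((Function.update n i 1 j : Fin 2) : ℕ)).prod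
      else 0 := by
  intro L
  induction L with
  | zero => intro c _ n i; exact i.elim0
  | succ L ih =>
    intro c hc n i
    have hsq : ∀ i, c i * c i = 0 := fun i => by
      have h := hc i i
      rw [← two_smul ℂ] at h
      exact (smul_eq_zero.mp h).resolve_left two_ne_zero
    simp only [List.ofFn_succ, List.prod_cons]
    refine Fin.cases ?_ (fun i => ?_) i
    · rw [← mul_assoc]
      split_ifs with h
      · simp [h, jwSign]
      · simp [fin_two_ne_zero.mp h, hsq]
    · have ih' := ih (fun j => c j.succ) (fun i j => hc _ _) (fun j => n j.succ) i
      have hup : ∀ j : Fin L, Function.update n i.succ 1 j.succ =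
          Function.update (fun j => n j.succ) i 1 j := fun j => by
        by_cases h : j = i
        · subst h; simp
        · rw [Function.update_of_ne h, Function.update_of_ne (by simpa using h)]
      have hs : jwSign i.succ n = (-1) ^ (n 0 : ℕ) * jwSign i (fun j => n j.succ) := by
        simp only [jwSign, Finset.sum_filter]
        rw [Fin.sum_univ_succ, pow_add]
        simp
      have hcomm : c i.succ * c 0 ^ (n 0 : ℕ) =
          ((-1 : ℂ) ^ (n 0 : ℕ)) • (c 0 ^ (n 0 : ℕ) * c i.succ) := by
        rcases eq_or_ne (n 0) 0 with h | h
        · simp [h]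
        · rw [fin_two_ne_zero] at h
          simpa [h] using eq_neg_of_add_eq_zero_left (hc i.succ 0)
      rw [← mul_assoc, hcomm, smul_mul_assoc, mul_assoc, ih',
        Function.update_of_ne (Fin.succ_ne_zero i).symm, hs]
      simp only [hup]
      split_ifs with h
      · rw [mul_smul_comm, smul_smul]
      · simp

theorem fockUnitary_mulVec_single {L : ℕ} (u : UL L) (n : Occ L) :
    fockUnitary u *ᵥ Pi.single n (1 : ℂ) =
      (List.ofFn fun i => rotCreate u i ^ (n i : ℕ)).prod *ᵥ vac L := by
  ext m
  simp [fockUnitary, vac, rotCreate]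

theorem fockUnitary_vac {L : ℕ} (u : UL L) : fockUnitary u *ᵥ vac L = vac L := by
  rw [vac, fockUnitary_mulVec_single]
  simp only [Pi.zero_apply, Fin.val_zero, pow_zero, List.ofFn_const, List.prod_replicate, one_pow,
    Matrix.one_mulVec, vac]

theorem fockUnitary_mul_create {L : ℕ} (u : UL L) (i : Fin L) :
    fockUnitary u * create i = rotCreate u i * fockUnitary u := by
  refine Matrix.ext_of_mulVec_single fun n => ?_
  rw [← Matrix.mulVec_mulVec, ← Matrix.mulVec_mulVec, create_mulVec_single,
    fockUnitary_mulVec_single, Matrix.mulVec_mulVec,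
    mul_prod_ofFn_pow _ (rotCreate_anticomm u)]
  split_ifs with h
  · rw [Matrix.mulVec_smul, fockUnitary_mulVec_single, Matrix.smul_mulVec]
  · simp

theorem fockUnitary_mul_annihilate {L : ℕ} (u : UL L) (i : Fin L) :
    fockUnitary u * annihilate i = rotAnnihilate u i * fockUnitary u := by
  refine ext_of_vac ?_ fun j v hv => ?_
  · rw [← Matrix.mulVec_mulVec, ← Matrix.mulVec_mulVec, annihilate_vac, fockUnitary_vac,
      rotAnnihilate_vac, Matrix.mulVec_zero]
  · have h1 : (annihilate i : FockOp L) * create j =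
        (1 : Matrix (Fin L) (Fin L) ℂ) i j • 1 - create j * annihilate i :=
      eq_sub_of_add_eq (annihilate_create i j)
    have h2 : rotAnnihilate u i * rotCreate u j =
        (1 : Matrix (Fin L) (Fin L) ℂ) i j • 1 - rotCreate u j * rotAnnihilate u i :=
      eq_sub_of_add_eq (rotAnnihilate_rotCreate u i j)
    rw [Matrix.mulVec_mulVec, Matrix.mulVec_mulVec, mul_assoc, mul_assoc, h1,
      fockUnitary_mul_create, ← mul_assoc _ (rotCreate u j), h2, mul_sub, sub_mul, mul_assoc,
      ← mul_assoc (fockUnitary u), fockUnitary_mul_create, mul_assoc, Matrix.sub_mulVec,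
      Matrix.sub_mulVec, ← Matrix.mulVec_mulVec _ (rotCreate u j),
      ← Matrix.mulVec_mulVec _ (rotCreate u j), hv]
    simp

theorem conjTranspose_rotAnnihilate {L : ℕ} (u : UL L) (i : Fin L) :
    (rotAnnihilate u i)ᴴ = rotCreate u i := by
  rw [← conjTranspose_rotCreate, Matrix.conjTranspose_conjTranspose]

theorem create_mul_conjTranspose_fockUnitary {L : ℕ} (u : UL L) (i : Fin L) :
    create i * (fockUnitary u)ᴴ = (fockUnitary u)ᴴ * rotCreate u i := by
  have := congrArg Matrix.conjTranspose (fockUnitary_mul_annihilate u i)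
  rwa [Matrix.conjTranspose_mul, Matrix.conjTranspose_mul, conjTranspose_rotAnnihilate] at this

theorem vecMul_prod_rotCreate {L : ℕ} (u : UL L) (n : Occ L) (hn : n ≠ 0) :
    vac L ᵥ* (List.ofFn fun i => rotCreate u i ^ (n i : ℕ)).prod = 0 := by
  have h0 : ∀ i, vac L ᵥ* rotCreate u i = 0 := fun i => by
    have := congrArg star (rotAnnihilate_vac u i)
    rw [Matrix.star_mulVec, conjTranspose_rotAnnihilate] at this
    have e : star (vac L) = vac L := by
      ext m; simp [vac, Pi.single_apply, apply_ite]
    simpa [e] using this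
  have key : ∀ l : List (Fin L), (∃ i ∈ l, n i ≠ 0) →
      vac L ᵥ* (l.map fun i => rotCreate u i ^ (n i : ℕ)).prod = 0 := by
    intro l
    induction l with
    | nil => simp
    | cons a l ih =>
      intro h
      rw [List.map_cons, List.prod_cons, ← Matrix.vecMul_vecMul]
      rcases eq_or_ne (n a) 0 with ha | ha
      · rw [ha]
        simp only [Fin.val_zero, pow_zero, Matrix.vecMul_one]
        refine ih ?_
        obtain ⟨i, hi, hi'⟩ := h
        rcases List.mem_cons.mp hi with rfl | hi
        · exact absurd ha hi'
        · exact ⟨i, hi, hi'⟩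
      · rw [fin_two_ne_zero] at ha
        simp [ha, h0]
  rw [List.ofFn_eq_map]
  refine key _ ?_
  obtain ⟨i, hi⟩ := Function.ne_iff.mp hn
  exact ⟨i, List.mem_finRange i, hi⟩

theorem conjTranspose_fockUnitary_vac {L : ℕ} (u : UL L) :
    (fockUnitary u)ᴴ *ᵥ vac L = vac L := by
  have h : vac L ᵥ* fockUnitary u = vac L := by
    ext n
    have e : (vac L ᵥ* fockUnitary u) n =
        (vac L ᵥ* (List.ofFn fun i => rotCreate u i ^ (n i : ℕ)).prod) 0 := by
      simp [vac, fockUnitary, rotCreate]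
    rw [e]
    by_cases hn : n = 0
    · subst hn; simp
    · rw [vecMul_prod_rotCreate u n hn, vac, Pi.single_eq_of_ne hn]; rfl
  have := congrArg star h
  rw [Matrix.star_vecMul] at this
  have e : star (vac L) = vac L := by
    ext m; simp [vac, Pi.single_apply, apply_ite]
  rwa [e] at this

theorem conjTranspose_mul_fockUnitary {L : ℕ} (u : UL L) :
    (fockUnitary u)ᴴ * fockUnitary u = 1 := by
  refine ext_of_vac ?_ fun j v hv => ?_
  · rw [← Matrix.mulVec_mulVec, fockUnitary_vac, conjTranspose_fockUnitary_vac, Matrix.one_mulVec]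
  · rw [Matrix.mulVec_mulVec, mul_assoc, fockUnitary_mul_create, ← mul_assoc,
      ← create_mul_conjTranspose_fockUnitary, mul_assoc, ← Matrix.mulVec_mulVec, hv,
      Matrix.one_mulVec, Matrix.one_mulVec]

theorem fockUnitary_mul_conjTranspose {L : ℕ} (u : UL L) :
    fockUnitary u * (fockUnitary u)ᴴ = 1 :=
  mul_eq_one_comm.mp (conjTranspose_mul_fockUnitary u)

theorem conj_create {L : ℕ} (u : UL L) (i : Fin L) :
    fockUnitary u * create i * (fockUnitary u)ᴴ = rotCreate u i := by
  rw [fockUnitary_mul_create, mul_assoc, fockUnitary_mul_conjTranspose, mul_one]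

theorem conj_annihilate {L : ℕ} (u : UL L) (i : Fin L) :
    fockUnitary u * annihilate i * (fockUnitary u)ᴴ = rotAnnihilate u i := by
  rw [fockUnitary_mul_annihilate, mul_assoc, fockUnitary_mul_conjTranspose, mul_one]

theorem conj'_create {L : ℕ} (u : UL L) (l : Fin L) :
    (fockUnitary u)ᴴ * create l * fockUnitary u = ∑ i, u.1 i l • create i := by
  rw [create_eq_sum_rotCreate u l, Finset.mul_sum, Finset.sum_mul]
  refine Finset.sum_congr rfl fun i _ => ?_
  rw [mul_smul_comm, smul_mul_assoc, ← create_mul_conjTranspose_fockUnitary, mul_assoc,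
    conjTranspose_mul_fockUnitary, mul_one]

theorem conj'_annihilate {L : ℕ} (u : UL L) (l : Fin L) :
    (fockUnitary u)ᴴ * annihilate l * fockUnitary u = ∑ i, conj (u.1 i l) • annihilate i := by
  have := congrArg Matrix.conjTranspose (conj'_create u l)
  simpa [Matrix.conjTranspose_mul, Matrix.conjTranspose_sum, conjTranspose_create, mul_assoc]
    using this

/-! ### Ordered products -/

theorem mul_prod_ofFn_mul {R : Type*} [Monoid R] {V W : R} (hVW : V * W = 1) (hWV : W * V = 1) :
    ∀ {k : ℕ} (A : Fin k → R),
      V * (List.ofFn A).prod * W = (List.ofFn fun r => V * A r * W).prod := by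
  intro k
  induction k with
  | zero => intro A; simp [hVW]
  | succ k ih =>
    intro A
    rw [List.ofFn_succ, List.ofFn_succ, List.prod_cons, List.prod_cons, ← ih]
    calc V * (A 0 * (List.ofFn fun i => A i.succ).prod) * W
        = V * A 0 * 1 * (List.ofFn fun i => A i.succ).prod * W := by simp only [mul_assoc, one_mul]
      _ = _ := by rw [← hWV]; simp only [mul_assoc]

theorem prod_ofFn_sum_smul {R : Type*} [Ring R] [Algebra ℂ R] {X : Type*} [Fintype X]
    (A : X → R) : ∀ {k : ℕ} (c : Fin k → X → ℂ),
      (List.ofFn fun r => ∑ x, c r x • A x).prod =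
        ∑ p : Fin k → X, (∏ r, c r (p r)) • (List.ofFn fun r => A (p r)).prod := by
  intro k
  induction k with
  | zero => intro c; simp
  | succ k ih =>
    intro c
    rw [List.ofFn_succ, List.prod_cons, ih, Finset.sum_mul_sum,
      ← (Fin.consEquiv fun _ => X).sum_comp, Fintype.sum_prod_type]
    refine Finset.sum_congr rfl fun x _ => Finset.sum_congr rfl fun p _ => ?_
    simp [Fin.prod_univ_succ, smul_smul, mul_comm, Fin.consEquiv]

theorem conjTranspose_prod_annihilate {L : ℕ} (l : List (Fin L)) :
    ((l.map annihilate).prod : FockOp L)ᴴ = (l.reverse.map create).prod := by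
  rw [Matrix.conjTranspose_list_prod, List.map_map, List.map_reverse]
  rfl

theorem corrOp_eq {L k : ℕ} (i j : Fin k → Fin L) :
    corrOp i j = (((List.ofFn i).reverse.map annihilate).prod : FockOp L)ᴴ *
      ((List.ofFn j).map annihilate).prod := by
  rw [conjTranspose_prod_annihilate, List.reverse_reverse, List.map_ofFn, List.map_ofFn]
  rfl

/-- The expansion of `U a_i† a_j U†` in correlation operators. -/
theorem conj_corrOp {L k : ℕ} (u : UL L) (i j : Fin k → Fin L) :
    fockUnitary u * corrOp i j * (fockUnitary u)ᴴ =
      ∑ p : Fin k → Fin L, ∑ q : Fin k → Fin L,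
        ((∏ r, conj (u.1 (i r) (p r))) * ∏ r, u.1 (j r) (q r)) • corrOp p q := by
  have hV := fockUnitary_mul_conjTranspose u
  have hW := conjTranspose_mul_fockUnitary u
  have : fockUnitary u * corrOp i j * (fockUnitary u)ᴴ =
      (fockUnitary u * (List.ofFn fun r => create (i r)).prod * (fockUnitary u)ᴴ) *
      (fockUnitary u * (List.ofFn fun r => annihilate (j r)).prod * (fockUnitary u)ᴴ) := by
    calc _ = fockUnitary u * (List.ofFn fun r => create (i r)).prod * 1 *
        (List.ofFn fun r => annihilate (j r)).prod * (fockUnitary u)ᴴ := by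
          simp only [corrOp, mul_assoc, one_mul]
      _ = _ := by rw [← hW]; simp only [mul_assoc]
  rw [this, mul_prod_ofFn_mul hV hW, mul_prod_ofFn_mul hV hW]
  simp only [conj_create, conj_annihilate, rotCreate, rotAnnihilate]
  rw [prod_ofFn_sum_smul create fun r x => conj (u.1 (i r) x),
    prod_ofFn_sum_smul annihilate fun r x => u.1 (j r) x, Finset.sum_mul_sum]
  simp only [smul_mul_smul_comm]
  rfl

/-- The expansion of `U† a_p† a_q U` in correlation operators. -/
theorem conj'_corrOp {L k : ℕ} (u : UL L) (p q : Fin k → Fin L) :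
    (fockUnitary u)ᴴ * corrOp p q * fockUnitary u =
      ∑ x : Fin k → Fin L, ∑ y : Fin k → Fin L,
        ((∏ r, u.1 (x r) (p r)) * ∏ r, conj (u.1 (y r) (q r))) • corrOp x y := by
  have hV := fockUnitary_mul_conjTranspose u
  have hW := conjTranspose_mul_fockUnitary u
  have : (fockUnitary u)ᴴ * corrOp p q * fockUnitary u =
      ((fockUnitary u)ᴴ * (List.ofFn fun r => create (p r)).prod * fockUnitary u) *
      ((fockUnitary u)ᴴ * (List.ofFn fun r => annihilate (q r)).prod * fockUnitary u) := by
    calc _ = (fockUnitary u)ᴴ * (List.ofFn fun r => create (p r)).prod * 1 *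
        (List.ofFn fun r => annihilate (q r)).prod * fockUnitary u := by
          simp only [corrOp, mul_assoc, one_mul]
      _ = _ := by rw [← hV]; simp only [mul_assoc]
  rw [this, mul_prod_ofFn_mul hW hV, mul_prod_ofFn_mul hW hV]
  simp only [conj'_create, conj'_annihilate]
  rw [prod_ofFn_sum_smul create fun r x => u.1 x (p r),
    prod_ofFn_sum_smul annihilate fun r x => conj (u.1 x (q r)), Finset.sum_mul_sum]
  simp only [smul_mul_smul_comm]
  rfl

/-! ### Matrix elements of correlation operators -/

theorem of_annihilate_ne_zero {L : ℕ} {j : Fin L} {m n : Occ L} (h : annihilate j m n ≠ 0) :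
    n j = 1 ∧ m = Function.update n j 0 := by
  by_contra h'
  exact h (by simp [annihilate, h'])

theorem of_prod_annihilate_ne_zero {L : ℕ} {l : List (Fin L)} : ∀ {m n : Occ L},
    (l.map annihilate).prod m n ≠ 0 →
      l.Nodup ∧ ∀ i, if i ∈ l then n i = 1 ∧ m i = 0 else m i = n i := by
  induction l with
  | nil =>
    intro m n h
    have : m = n := by
      by_contra hmn
      exact h (by simp [Matrix.one_apply_ne hmn])
    simp [this]
  | cons a l ih =>
    intro m n h
    rw [List.map_cons, List.prod_cons, Matrix.mul_apply] at h
    obtain ⟨x, -, hx⟩ := Finset.exists_ne_zero_of_sum_ne_zero h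
    obtain ⟨h1, h2⟩ := of_annihilate_ne_zero (left_ne_zero_of_mul hx)
    obtain ⟨h3, h4⟩ := ih (right_ne_zero_of_mul hx)
    have ha : a ∉ l := fun ha => by
      have := h4 a
      rw [if_pos ha, h1] at this
      exact absurd this.2 one_ne_zero
    refine ⟨List.nodup_cons.mpr ⟨ha, h3⟩, fun i => ?_⟩
    have h4i := h4 i
    by_cases hi : i = a
    · subst hi
      rw [if_neg ha] at h4i
      simp [h2, ← h4i, h1]
    · simpa [hi, h2] using h4i

theorem of_corrOp_ne_zero {L k : ℕ} {p q : Fin k → Fin L} {m n : Occ L}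
    (h : corrOp p q m n ≠ 0) : Function.Injective p ∧ Function.Injective q ∧ ∃ x : Occ L,
      (∀ i, if i ∈ Set.range p then m i = 1 ∧ x i = 0 else x i = m i) ∧
      (∀ i, if i ∈ Set.range q then n i = 1 ∧ x i = 0 else x i = n i) := by
  classical
  rw [corrOp_eq, Matrix.mul_apply] at h
  obtain ⟨x, -, hx⟩ := Finset.exists_ne_zero_of_sum_ne_zero h
  have hx1 := left_ne_zero_of_mul hx
  rw [Matrix.conjTranspose_apply, star_ne_zero] at hx1
  obtain ⟨h1, h2⟩ := of_prod_annihilate_ne_zero hx1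
  obtain ⟨h3, h4⟩ := of_prod_annihilate_ne_zero (right_ne_zero_of_mul hx)
  rw [List.nodup_reverse] at h1
  simp only [List.mem_reverse, List.mem_ofFn] at h2 h4
  exact ⟨List.nodup_ofFn.mp h1, List.nodup_ofFn.mp h3, x,
    fun i => by simpa [Set.mem_range] using h2 i, fun i => by simpa [Set.mem_range] using h4 i⟩

theorem corrOp_eq_zero {L k : ℕ} {p q : Fin k → Fin L}
    (h : ¬ (Function.Injective p ∧ Function.Injective q)) : corrOp p q = 0 := by
  ext m n
  by_contra hmn
  obtain ⟨h1, h2, -⟩ := of_corrOp_ne_zero hmn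
  exact h ⟨h1, h2⟩

open Classical in
/-- The pairs of index tuples that are rearrangements of each other. -/
def permPairs (L k : ℕ) : Finset ((Fin k → Fin L) × (Fin k → Fin L)) :=
  Finset.univ.filter fun p => ∃ σ : Equiv.Perm (Fin k), p.2 = p.1 ∘ σ

theorem card_permPairs_le (L k : ℕ) : (permPairs L k).card ≤ L ^ k * k.factorial := by
  classical
  have : permPairs L k ⊆ (Finset.univ : Finset ((Fin k → Fin L) × Equiv.Perm (Fin k))).image
      fun p => (p.1, p.1 ∘ p.2) := by
    intro p hp
    obtain ⟨σ, hσ⟩ := (Finset.mem_filter.mp hp).2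
    exact Finset.mem_image.mpr ⟨(p.1, σ), Finset.mem_univ _, Prod.ext rfl hσ.symm⟩
  refine (Finset.card_le_card this).trans (Finset.card_image_le.trans ?_)
  simp [Fintype.card_perm]

theorem diagonal_corrOp_of_mem {L k : ℕ} {p q : Fin k → Fin L} (h : (p, q) ∈ permPairs L k) :
    Matrix.diagonal (fun n => corrOp p q n n) = corrOp p q := by
  obtain ⟨σ, hσ⟩ := (Finset.mem_filter.mp h).2
  have hr : Set.range q = Set.range p := by
    rw [show q = p ∘ σ from hσ, σ.surjective.range_comp]
  ext m n
  rcases eq_or_ne m n with rfl | hmn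
  · simp
  · rw [Matrix.diagonal_apply_ne _ hmn]
    by_contra h0
    obtain ⟨-, -, x, h1, h2⟩ := of_corrOp_ne_zero (Ne.symm h0)
    refine hmn (funext fun i => ?_)
    have h1 := h1 i
    have h2 := h2 i
    simp only [hr] at h2
    split_ifs at h1 h2
    · rw [h1.1, h2.1]
    · rw [← h1, ← h2]

theorem corrOp_apply_self_of_notMem {L k : ℕ} {p q : Fin k → Fin L} (h : (p, q) ∉ permPairs L k)
    (n : Occ L) : corrOp p q n n = 0 := by
  by_contra h0
  obtain ⟨hp, hq, x, h1, h2⟩ := of_corrOp_ne_zero h0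
  have hr : Set.range q = Set.range p := by
    ext i
    have h1 := h1 i
    have h2 := h2 i
    split_ifs at h1 h2 with h3 h4 h4
    · simp [h3, h4]
    · rw [h1.1, h1.2] at h2
      exact absurd h2 zero_ne_one
    · rw [h2.1, h2.2] at h1
      exact absurd h1 zero_ne_one
    · simp [h3, h4]
  refine h (Finset.mem_filter.mpr ⟨Finset.mem_univ _,
    (Equiv.ofInjective q hq).trans ((Equiv.setCongr hr).trans (Equiv.ofInjective p hp).symm), ?_⟩)
  funext r
  simp [Equiv.apply_ofInjective_symm]

/-! ### The measurement channel on correlation operators -/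

theorem channelIntegrand_eq {L : ℕ} (u : UL L) (A : FockOp L) :
    channelIntegrand u A = (fockUnitary u)ᴴ *
      Matrix.diagonal (fun n => (fockUnitary u * A * (fockUnitary u)ᴴ) n n) * fockUnitary u := by
  rw [← Matrix.sum_single_eq_diagonal, Finset.mul_sum, Finset.sum_mul]
  refine Finset.sum_congr rfl fun n _ => ?_
  rw [diagEntry, ← smul_mul_assoc, ← mul_smul_comm, Matrix.smul_single, smul_eq_mul, mul_one]

/-- The coefficients of `channelIntegrand u (corrOp i j)`, which are matrix elements of
`u^{⊗2k} ⊗ (u^*)^{⊗2k}`. -/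
theorem channelIntegrand_corrOp {L k : ℕ} (u : UL L) (i j : Fin k → Fin L) :
    channelIntegrand u (corrOp i j) =
      ∑ z ∈ permPairs L k, ∑ x : Fin k → Fin L, ∑ y : Fin k → Fin L,
        ((∏ r, conj (u.1 (i r) (z.1 r))) * (∏ r, u.1 (j r) (z.2 r)) *
          ((∏ r, u.1 (x r) (z.1 r)) * ∏ r, conj (u.1 (y r) (z.2 r)))) • corrOp x y := by
  have h : Matrix.diagonal (fun n => (fockUnitary u * corrOp i j * (fockUnitary u)ᴴ) n n) =
      ∑ z ∈ permPairs L k, ((∏ r, conj (u.1 (i r) (z.1 r))) * ∏ r, u.1 (j r) (z.2 r)) •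
        corrOp z.1 z.2 := by
    have e : ∑ z ∈ permPairs L k, ((∏ r, conj (u.1 (i r) (z.1 r))) * ∏ r, u.1 (j r) (z.2 r)) •
        corrOp z.1 z.2 = ∑ z : (Fin k → Fin L) × (Fin k → Fin L),
        ((∏ r, conj (u.1 (i r) (z.1 r))) * ∏ r, u.1 (j r) (z.2 r)) •
        Matrix.diagonal (fun n => corrOp z.1 z.2 n n) := by
      rw [← Finset.sum_subset (Finset.subset_univ (permPairs L k))]
      · exact Finset.sum_congr rfl fun z hz => by rw [diagonal_corrOp_of_mem hz]
      · intro z _ hz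
        simp [corrOp_apply_self_of_notMem hz]
    rw [e, Fintype.sum_prod_type, conj_corrOp]
    ext m n
    rcases eq_or_ne m n with rfl | hmn
    · simp [Matrix.sum_apply]
    · simp [Matrix.sum_apply, hmn]
  rw [channelIntegrand_eq, h, Finset.mul_sum, Finset.sum_mul]
  refine Finset.sum_congr rfl fun z _ => ?_
  rw [mul_smul_comm, smul_mul_assoc, conj'_corrOp, Finset.smul_sum]
  refine Finset.sum_congr rfl fun x _ => ?_
  rw [Finset.smul_sum]
  exact Finset.sum_congr rfl fun y _ => by rw [smul_smul]

/-- The juxtaposition of two index tuples of length `k`. -/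
def joinTuple {L k : ℕ} (x y : Fin k → Fin L) : Fin (2 * k) → Fin L :=
  fun a => Fin.append x y (Fin.cast (two_mul k) a)

theorem prod_joinTuple {L k : ℕ} (f : Fin L → Fin L → ℂ) (x y x' y' : Fin k → Fin L) :
    ∏ a, f (joinTuple x y a) (joinTuple x' y' a) = (∏ r, f (x r) (x' r)) * ∏ r, f (y r) (y' r) := by
  rw [← (finCongr (two_mul k).symm).prod_comp, Fin.prod_univ_add]
  simp only [joinTuple, finCongr_apply, Fin.cast_cast, Fin.cast_eq_self,
    Fin.append_left, Fin.append_right]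

theorem measurementChannel_corrOp {L k : ℕ} (ν : Measure (UL L)) [IsFiniteMeasure ν]
    (i j : Fin k → Fin L) :
    measurementChannel ν (corrOp i j) =
      ∑ z ∈ permPairs L k, ∑ x : Fin k → Fin L, ∑ y : Fin k → Fin L,
        momentOp (2 * k) ν (joinTuple j x, joinTuple i y) (joinTuple z.2 z.1, joinTuple z.1 z.2) •
          corrOp x y := by
  ext m n
  change ∫ u, channelIntegrand u (corrOp i j) m n ∂ν = _
  have hc : ∀ i j : Fin L, Continuous fun u : UL L => u.1 i j :=
    fun i j => continuous_subtype_val.matrix_elem i j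
  have hc' : ∀ i j : Fin L, Continuous fun u : UL L => conj (u.1 i j) :=
    fun i j => Complex.continuous_conj.comp (hc i j)
  have hg : ∀ (z : (Fin k → Fin L) × (Fin k → Fin L)) (x y : Fin k → Fin L),
      Continuous fun u : UL L => ((∏ r, conj (u.1 (i r) (z.1 r))) * (∏ r, u.1 (j r) (z.2 r)) *
          ((∏ r, u.1 (x r) (z.1 r)) * ∏ r, conj (u.1 (y r) (z.2 r)))) * corrOp x y m n :=
    fun z x y => (((continuous_finsetProd _ fun _ _ => hc' _ _).mul
      (continuous_finsetProd _ fun _ _ => hc _ _)).mul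
      ((continuous_finsetProd _ fun _ _ => hc _ _).mul
      (continuous_finsetProd _ fun _ _ => hc' _ _))).mul continuous_const
  have hi : ∀ f : UL L → ℂ, Continuous f → Integrable f ν := fun f hf =>
    hf.integrable_of_hasCompactSupport (HasCompactSupport.of_compactSpace _)
  simp only [channelIntegrand_corrOp, Matrix.sum_apply, Matrix.smul_apply, smul_eq_mul]
  rw [integral_finsetSum _ fun z _ => hi _ (continuous_finsetSum _ fun x _ => continuous_finsetSum _ fun y _ => hg z x y)]
  refine Finset.sum_congr rfl fun z _ => ?_
  rw [integral_finsetSum _ fun x _ => hi _ (continuous_finsetSum _ fun y _ => hg z x y)]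
  refine Finset.sum_congr rfl fun x _ => ?_
  rw [integral_finsetSum _ fun y _ => hi _ (hg z x y)]
  refine Finset.sum_congr rfl fun y _ => ?_
  rw [integral_mul_const]
  congr 1
  refine integral_congr_ae (Filter.Eventually.of_forall fun u => ?_)
  simp only [Matrix.kroneckerMap_apply, tensorPow, Matrix.of_apply, Matrix.map_apply]
  rw [prod_joinTuple (fun a b => u.1 a b), prod_joinTuple (fun a b => conj (u.1 a b))]
  ring

/-! ### Norm bounds -/

section Norm

open scoped Matrix.Norms.L2Operator

theorem norm_annihilate_le {L : ℕ} (j : Fin L) : ‖(annihilate j : FockOp L)‖ ≤ 1 := by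
  have hsq : (annihilate j : FockOp L) * annihilate j = 0 := by
    have h := annihilate_anticomm j j
    rw [← two_smul ℂ] at h
    exact (smul_eq_zero.mp h).resolve_left two_ne_zero
  have hc : (annihilate j : FockOp L) * (annihilate j)ᴴ = 1 - (annihilate j)ᴴ * annihilate j := by
    have h := annihilate_create j j
    rw [Matrix.one_apply_eq, one_smul] at h
    exact eq_sub_of_add_eq h
  set a : FockOp L := annihilate j
  have hP : (aᴴ * a)ᴴ * (aᴴ * a) = aᴴ * a := by
    rw [Matrix.conjTranspose_mul, Matrix.conjTranspose_conjTranspose,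
      show aᴴ * a * (aᴴ * a) = aᴴ * (a * aᴴ) * a by simp only [mul_assoc], hc, mul_sub, sub_mul,
      mul_one, show aᴴ * (aᴴ * a) * a = aᴴ * aᴴ * (a * a) by simp only [mul_assoc], hsq, mul_zero,
      sub_zero]
  have h1 : ‖aᴴ * a‖ = ‖a‖ * ‖a‖ := Matrix.l2_opNorm_conjTranspose_mul_self a
  have h2 := Matrix.l2_opNorm_conjTranspose_mul_self (aᴴ * a)
  rw [hP, h1] at h2
  have h3 := norm_nonneg a
  by_contra! h
  have h4 : 1 < ‖a‖ * ‖a‖ := by nlinarith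
  nlinarith

theorem norm_one_le {n : Type*} [Fintype n] [DecidableEq n] : ‖(1 : Matrix n n ℂ)‖ ≤ 1 := by
  rw [← Matrix.diagonal_one, Matrix.l2_opNorm_diagonal]
  exact (pi_norm_le_iff_of_nonneg zero_le_one).mpr fun _ => by simp

theorem norm_list_prod_le_one {n : Type*} [Fintype n] [DecidableEq n] :
    ∀ l : List (Matrix n n ℂ), (∀ A ∈ l, ‖A‖ ≤ 1) → ‖l.prod‖ ≤ 1
  | [], _ => by simpa using norm_one_le
  | A :: l, h => by
    rw [List.prod_cons]
    refine (norm_mul_le _ _).trans (mul_le_one₀ (h A (by simp)) (norm_nonneg _) ?_)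
    exact norm_list_prod_le_one l fun B hB => h B (by simp [hB])

theorem norm_corrOp_le {L k : ℕ} (i j : Fin k → Fin L) : ‖corrOp i j‖ ≤ 1 := by
  have h : ∀ l : List (Fin L), ‖((l.map annihilate).prod : FockOp L)‖ ≤ 1 := fun l => by
    refine norm_list_prod_le_one _ fun A hA => ?_
    obtain ⟨i, -, rfl⟩ := List.mem_map.mp hA
    exact norm_annihilate_le i
  rw [corrOp_eq]
  refine (norm_mul_le _ _).trans (mul_le_one₀ ?_ (norm_nonneg _) (h _))
  rw [Matrix.l2_opNorm_conjTranspose]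
  exact h _

theorem norm_conj_apply_self_le {n : Type*} [Fintype n] [DecidableEq n] (B A : Matrix n n ℂ)
    (hA : ‖A‖ ≤ 1) (i : n) : ‖(B * A * Bᴴ) i i‖ ≤ ((B * Bᴴ) i i).re := by
  set w : EuclideanSpace ℂ n := WithLp.toLp 2 fun x => conj (B i x)
  have h1 : (B * A * Bᴴ) i i = inner ℂ w (WithLp.toLp 2 (A *ᵥ w.ofLp)) := by
    simp only [PiLp.inner_apply, Matrix.mul_assoc, Matrix.mul_apply (M := B)]
    refine Finset.sum_congr rfl fun x _ => ?_
    simp [w, Matrix.mul_apply, Matrix.mulVec, dotProduct, mul_comm]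
  have h2 : (B * Bᴴ) i i = inner ℂ w w := by
    simp only [PiLp.inner_apply, Matrix.mul_apply]
    refine Finset.sum_congr rfl fun x _ => ?_
    simp [w, Complex.mul_conj']
  rw [h1, h2]
  refine (norm_inner_le_norm _ _).trans ?_
  have h3 : ‖(WithLp.toLp 2 (A *ᵥ w.ofLp) : EuclideanSpace ℂ n)‖ ≤ ‖w‖ :=
    (Matrix.l2_opNorm_mulVec A w).trans (mul_le_of_le_one_left (norm_nonneg _) hA)
  refine (mul_le_mul_of_nonneg_left h3 (norm_nonneg _)).trans ?_
  rw [← inner_self_eq_norm_mul_norm (𝕜 := ℂ)]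
  rfl

theorem norm_diagEntry_corrOp_le {L k : ℕ} (u : UL L) (i j : Fin k → Fin L) (n : Occ L) :
    ‖diagEntry u (corrOp i j) n‖ ≤ 1 := by
  have := norm_conj_apply_self_le (fockUnitary u) _ (norm_corrOp_le i j) n
  rwa [fockUnitary_mul_conjTranspose, Matrix.one_apply_eq, Complex.one_re] at this

open scoped MatrixOrder in
theorem norm_trace_mul_corrOp_le {L k : ℕ} {ρ : FockOp L} (hρ : IsState ρ)
    (i j : Fin k → Fin L) : ‖(ρ * corrOp i j).trace‖ ≤ 1 := by
  obtain ⟨B, hB⟩ := CStarAlgebra.nonneg_iff_eq_star_mul_self.mp hρ.posSemidef.nonneg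
  rw [Matrix.star_eq_conjTranspose] at hB
  have h1 : (ρ * corrOp i j).trace = (B * corrOp i j * Bᴴ).trace := by
    rw [hB, mul_assoc, Matrix.trace_mul_comm]
  have h2 : (B * Bᴴ).trace = 1 := by
    rw [Matrix.trace_mul_comm, ← hB, hρ.trace_eq_one]
  rw [h1]
  refine (norm_sum_le _ _).trans ((Finset.sum_le_sum fun n _ =>
    norm_conj_apply_self_le B _ (norm_corrOp_le i j) n).trans ?_)
  have h3 := congrArg Complex.re h2
  rw [Matrix.trace, Complex.re_sum] at h3
  exact h3.le

theorem norm_apply_le_opNorm {ι : Type*} [Fintype ι] [DecidableEq ι] (A : Matrix ι ι ℂ)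
    (x y : ι) : ‖A x y‖ ≤ opNorm A := by
  have h := (Matrix.toEuclideanCLM (n := ι) (𝕜 := ℂ) A).le_opNorm (EuclideanSpace.single y 1)
  rw [PiLp.norm_single, norm_one, mul_one] at h
  refine le_trans ?_ ((PiLp.norm_apply_le _ x).trans h)
  simp [Matrix.ofLp_toEuclideanCLM]

theorem opNorm_nonneg {ι : Type*} [Fintype ι] [DecidableEq ι] (A : Matrix ι ι ℂ) :
    0 ≤ opNorm A := norm_nonneg _

end Norm

/-! ### The standard basis spans -/

theorem prod_map_perm {X R : Type*} [Ring R] (c : X → R) (hc : ∀ i j, c i * c j + c j * c i = 0)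
    {l l' : List X} (h : l.Perm l') :
    (l.map c).prod = (l'.map c).prod ∨ (l.map c).prod = -(l'.map c).prod := by
  induction h with
  | nil => simp
  | cons x _ ih => rcases ih with ih | ih <;> simp [ih]
  | swap x y l =>
    right
    simp only [List.map_cons, List.prod_cons]
    rw [← mul_assoc, ← mul_assoc, ← neg_mul, eq_neg_of_add_eq_zero_left (hc y x)]
  | trans _ _ ih1 ih2 =>
    rcases ih1 with h1 | h1 <;> rcases ih2 with h2 | h2 <;> simp [h1, h2]

theorem corrOp_comp_perm {L k : ℕ} (i j : Fin k → Fin L) (σ τ : Equiv.Perm (Fin k)) :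
    corrOp i j = corrOp (i ∘ σ) (j ∘ τ) ∨ corrOp i j = -corrOp (i ∘ σ) (j ∘ τ) := by
  have e : ∀ (c : Fin L → FockOp L) (i : Fin k → Fin L),
      (List.ofFn fun r => c (i r)).prod = ((List.ofFn i).map c).prod := fun c i => by
    rw [List.map_ofFn]; rfl
  simp only [corrOp, e]
  rcases prod_map_perm create create_anticomm (Equiv.Perm.ofFn_comp_perm σ i) with h1 | h1 <;>
  rcases prod_map_perm annihilate annihilate_anticomm (Equiv.Perm.ofFn_comp_perm τ j)
    with h2 | h2 <;>
    simp only [h1, h2, neg_mul, mul_neg, neg_neg, true_or, or_true]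

theorem corrSpace_eq_span_basisOp (L k : ℕ) :
    corrSpace L k = Submodule.span ℂ (Set.range (basisOp : BasisIdx L k → FockOp L)) := by
  refine le_antisymm (Submodule.span_le.mpr ?_) (Submodule.span_mono ?_)
  · rintro _ ⟨⟨i, j⟩, rfl⟩
    by_cases h : Function.Injective i ∧ Function.Injective j
    · have hi := (Tuple.monotone_sort i).strictMono_of_injective
        (h.1.comp (Tuple.sort i).injective)
      have hj := (Tuple.monotone_sort j).strictMono_of_injective
        (h.2.comp (Tuple.sort j).injective)
      have hm : corrOp (i ∘ Tuple.sort i) (j ∘ Tuple.sort j) ∈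
          Submodule.span ℂ (Set.range (basisOp : BasisIdx L k → FockOp L)) :=
        Submodule.subset_span ⟨(⟨_, hi⟩, ⟨_, hj⟩), rfl⟩
      change corrOp i j ∈ _
      rcases corrOp_comp_perm i j (Tuple.sort i) (Tuple.sort j) with h | h
      · rwa [h]
      · rw [h]; exact Submodule.neg_mem _ hm
    · simp only [corrOp_eq_zero h]
      exact Submodule.zero_mem _
  · rintro _ ⟨l, rfl⟩
    exact ⟨(l.1.1, l.2.1), rfl⟩

theorem eq_sum_coeff {L k : ℕ} {O : FockOp L} (hO : O ∈ corrSpace L k) :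
    O = ∑ l, coeff k O l • basisOp l := by
  have h : ∃ c : BasisIdx L k → ℂ, O = ∑ l, c l • basisOp l := by
    rw [corrSpace_eq_span_basisOp, Submodule.mem_span_range_iff_exists_fun] at hO
    obtain ⟨c, hc⟩ := hO
    exact ⟨c, hc.symm⟩
  rw [coeff, dif_pos h]
  exact h.choose_spec

/-! ### The pseudo-inverse preserves the space of correlation operators -/

theorem eq_of_trace_conjTranspose_mul {n : Type*} [Fintype n] {A B : Matrix n n ℂ}
    (h : ∀ C, (Aᴴ * C).trace = (Bᴴ * C).trace) : A = B := by
  have h1 := h (A - B)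
  rw [← sub_eq_zero, ← Matrix.trace_sub, ← sub_mul, ← Matrix.conjTranspose_sub,
    Matrix.trace_conjTranspose_mul_self_eq_zero_iff] at h1
  exact sub_eq_zero.mp h1

/-- The pseudo-inverse of a self-adjoint map preserves each invariant subspace of the map. -/
theorem IsMoorePenrose.apply_mem {n : Type*} [Fintype n] {M P : Matrix n n ℂ →ₗ[ℂ] Matrix n n ℂ}
    (h : IsMoorePenrose M P) (hM : ∀ A B, ((M A)ᴴ * B).trace = (Aᴴ * M B).trace)
    {W : Submodule ℂ (Matrix n n ℂ)} (hW : ∀ A ∈ W, M A ∈ W) {A : Matrix n n ℂ} (hA : A ∈ W) :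
    P A ∈ W := by
  let T : W →ₗ[ℂ] W := M.restrict hW
  have hd : Disjoint (LinearMap.range T) (LinearMap.ker T) := by
    rw [Submodule.disjoint_def]
    rintro _ ⟨z, rfl⟩ hx
    have h0 : M (M z) = 0 := congrArg Subtype.val (LinearMap.mem_ker.mp hx)
    have h1 := hM z (M z)
    rw [h0, mul_zero, Matrix.trace_zero, Matrix.trace_conjTranspose_mul_self_eq_zero_iff] at h1
    exact Subtype.ext h1
  have htop : LinearMap.range T ⊔ LinearMap.ker T = ⊤ := by
    refine Submodule.eq_top_of_disjoint _ _ ?_ hd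
    exact (LinearMap.finrank_range_add_finrank_ker T).ge
  have hdec : ∀ x : W, ∃ z y : W, T y = 0 ∧ x = T z + y := fun x => by
    obtain ⟨_, ⟨z, rfl⟩, y, hy, hxy⟩ := Submodule.mem_sup.mp
      (show x ∈ LinearMap.range T ⊔ LinearMap.ker T by rw [htop]; trivial)
    exact ⟨z, y, hy, hxy.symm⟩
  obtain ⟨z, y, hy, hx⟩ := hdec ⟨A, hA⟩
  obtain ⟨w, y', hy', hz⟩ := hdec z
  have hA' : A = M (M w) + y := by
    have := congrArg Subtype.val hx
    rw [hz, map_add, hy', add_zero] at this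
    exact this
  have h1 : P (M (M w)) = M w := eq_of_trace_conjTranspose_mul fun C => by
    rw [h.selfAdjoint_right, hM, h.mul_mul_self, hM]
  have h2 : P y = 0 := by
    have : M (P y) = 0 := eq_of_trace_conjTranspose_mul fun C => by
      rw [h.selfAdjoint_left, ← hM, show M y = 0 from congrArg Subtype.val hy]
      simp
    rw [← h.inv_mul_inv, this, map_zero]
  rw [hA', map_add, h1, h2, add_zero]
  exact hW w w.2

theorem pinv_isMoorePenrose {n : Type*} [Fintype n] (M : Matrix n n ℂ →ₗ[ℂ] Matrix n n ℂ) :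
    IsMoorePenrose M (pinv M) := (exists_isMoorePenrose M).choose_spec

theorem trace_mul_measurementChannel {L : ℕ} (ν : Measure (UL L)) [IsFiniteMeasure ν]
    (A B : FockOp L) :
    (A * measurementChannel ν B).trace = ∫ u, (A * channelIntegrand u B).trace ∂ν := by
  have hi := integrable_channelIntegrand ν B
  simp only [Matrix.trace, Matrix.diag, Matrix.mul_apply]
  refine Eq.symm ((integral_finsetSum _ fun p _ => integrable_finsetSum _ fun q _ =>
    (hi q p).const_mul (A p q)).trans ?_)
  refine Finset.sum_congr rfl fun p _ => ?_
  refine (integral_finsetSum _ fun q _ => (hi q p).const_mul (A p q)).trans ?_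
  exact Finset.sum_congr rfl fun q _ => integral_const_mul _ _

theorem trace_mul_channelIntegrand {L : ℕ} (u : UL L) (A B : FockOp L) :
    (A * channelIntegrand u B).trace = ∑ n, diagEntry u A n * diagEntry u B n := by
  rw [channelIntegrand, Finset.mul_sum, Matrix.trace_sum]
  refine Finset.sum_congr rfl fun n _ => ?_
  rw [mul_smul_comm, Matrix.trace_smul, smul_eq_mul, mul_comm, ← mul_assoc, Matrix.trace_mul_comm,
    ← mul_assoc, ← mul_assoc, Matrix.trace_mul_single]
  simp [diagEntry]

theorem diagEntry_conjTranspose {L : ℕ} (u : UL L) (A : FockOp L) (n : Occ L) :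
    diagEntry u Aᴴ n = conj (diagEntry u A n) := by
  have : fockUnitary u * Aᴴ * (fockUnitary u)ᴴ = (fockUnitary u * A * (fockUnitary u)ᴴ)ᴴ := by
    simp [Matrix.conjTranspose_mul, mul_assoc]
  rw [diagEntry, this]
  rfl

theorem measurementChannel_selfAdjoint {L : ℕ} (ν : Measure (UL L)) [IsFiniteMeasure ν]
    (A B : FockOp L) :
    ((measurementChannel ν A)ᴴ * B).trace = (Aᴴ * measurementChannel ν B).trace := by
  have h : ((measurementChannel ν A)ᴴ * B).trace =
      conj (Bᴴ * measurementChannel ν A).trace := by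
    have := Matrix.trace_conjTranspose (Bᴴ * measurementChannel ν A)
    rw [Matrix.conjTranspose_mul, Matrix.conjTranspose_conjTranspose] at this
    exact this
  rw [h, trace_mul_measurementChannel, trace_mul_measurementChannel, ← integral_conj]
  refine integral_congr_ae (Filter.Eventually.of_forall fun u => ?_)
  simp [trace_mul_channelIntegrand, diagEntry_conjTranspose, mul_comm]

theorem measurementChannel_mem_corrSpace {L k : ℕ} (ν : Measure (UL L)) [IsFiniteMeasure ν]
    {A : FockOp L} (hA : A ∈ corrSpace L k) : measurementChannel ν A ∈ corrSpace L k := by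
  suffices h : corrSpace L k ≤ (corrSpace L k).comap (measurementChannel ν) from h hA
  refine Submodule.span_le.mpr ?_
  rintro _ ⟨p, rfl⟩
  change measurementChannel ν (corrOp p.1 p.2) ∈ corrSpace L k
  rw [measurementChannel_corrOp]
  exact Submodule.sum_mem _ fun z _ => Submodule.sum_mem _ fun x _ => Submodule.sum_mem _
    fun y _ => Submodule.smul_mem _ _ (Submodule.subset_span ⟨(x, y), rfl⟩)

/-- The coefficient of `A_s` in `ℳ⁺(O)`. -/
def pinvCoeff {L : ℕ} [NeZero L] (k : ℕ) (O : FockOp L) (s : BasisIdx L k) : ℂ :=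
  ∑ l : BasisIdx L k, coeff k (pinv (symChannel L) (basisOp l)) s * coeff k O l

theorem fBound_eq {L : ℕ} [NeZero L] (k : ℕ) (O : FockOp L) :
    fBound k O = ∑ s, ‖pinvCoeff k O s‖ := rfl

theorem fBound_nonneg {L : ℕ} [NeZero L] (k : ℕ) (O : FockOp L) : 0 ≤ fBound k O :=
  Finset.sum_nonneg fun _ _ => norm_nonneg _

theorem pinv_eq_sum {L k : ℕ} [NeZero L] {O : FockOp L} (hO : O ∈ corrSpace L k) :
    pinv (symChannel L) O = ∑ s, pinvCoeff k O s • basisOp s := by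
  have h : ∀ l : BasisIdx L k, pinv (symChannel L) (basisOp l) =
      ∑ s, coeff k (pinv (symChannel L) (basisOp l)) s • basisOp s := fun l =>
    eq_sum_coeff ((pinv_isMoorePenrose _).apply_mem
      (measurementChannel_selfAdjoint (symEnsemble L))
      (fun _ hA => measurementChannel_mem_corrSpace _ hA)
      (Submodule.subset_span ⟨(l.1.1, l.2.1), rfl⟩))
  conv_lhs => rw [eq_sum_coeff hO, map_sum]
  simp only [map_smul, pinvCoeff, Finset.sum_smul]
  rw [Finset.sum_comm]
  refine Finset.sum_congr rfl fun l _ => ?_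
  conv_lhs => rw [h l, Finset.smul_sum]
  exact Finset.sum_congr rfl fun s _ => by rw [smul_smul, mul_comm]

theorem diagEntry_sum_smul {L : ℕ} {ι : Type*} (s : Finset ι) (u : UL L) (c : ι → ℂ)
    (A : ι → FockOp L) (n : Occ L) :
    diagEntry u (∑ i ∈ s, c i • A i) n = ∑ i ∈ s, c i * diagEntry u (A i) n := by
  simp [diagEntry, Finset.mul_sum, Finset.sum_mul, Matrix.sum_apply]

theorem norm_singleShot_le {L k : ℕ} [NeZero L] {O : FockOp L} (hO : O ∈ corrSpace L k)
    (z : UL L × Occ L) : ‖singleShot O z‖ ≤ fBound k O := by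
  rw [singleShot, pinv_eq_sum hO, diagEntry_sum_smul, fBound_eq]
  refine (norm_sum_le _ _).trans (Finset.sum_le_sum fun s _ => ?_)
  rw [norm_mul]
  exact mul_le_of_le_one_right (norm_nonneg _) (norm_diagEntry_corrOp_le _ _ _ _)

/-! ### The bias -/

theorem norm_trace_sub_corrOp_le {L k : ℕ} (ν μ : Measure (UL L)) [IsFiniteMeasure ν]
    [IsFiniteMeasure μ] {ρ : FockOp L} (hρ : IsState ρ) (i j : Fin k → Fin L) :
    ‖(ρ * measurementChannel ν (corrOp i j)).trace -
      (ρ * measurementChannel μ (corrOp i j)).trace‖ ≤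
      opNorm (momentOp (2 * k) ν - momentOp (2 * k) μ) * (k.factorial * (L : ℝ) ^ (3 * k)) := by
  set Δ := momentOp (2 * k) ν - momentOp (2 * k) μ
  have h : (ρ * measurementChannel ν (corrOp i j)).trace -
      (ρ * measurementChannel μ (corrOp i j)).trace =
      ∑ z ∈ permPairs L k, ∑ x : Fin k → Fin L, ∑ y : Fin k → Fin L,
        Δ (joinTuple j x, joinTuple i y) (joinTuple z.2 z.1, joinTuple z.1 z.2) *
          (ρ * corrOp x y).trace := by
    simp only [measurementChannel_corrOp, Finset.mul_sum, Matrix.trace_sum, mul_smul_comm,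
      Matrix.trace_smul, smul_eq_mul, ← Finset.sum_sub_distrib, ← sub_mul]
    rfl
  have hb : ∀ (z : (Fin k → Fin L) × (Fin k → Fin L)) (x y : Fin k → Fin L),
      ‖Δ (joinTuple j x, joinTuple i y) (joinTuple z.2 z.1, joinTuple z.1 z.2) *
          (ρ * corrOp x y).trace‖ ≤ opNorm Δ := fun z x y => by
    rw [norm_mul]
    exact (mul_le_mul (norm_apply_le_opNorm Δ _ _) (norm_trace_mul_corrOp_le hρ x y)
      (norm_nonneg _) (opNorm_nonneg _)).trans (mul_one _).le
  rw [h]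
  have hb' := norm_sum_le_of_le (permPairs L k) fun z _ =>
    norm_sum_le_of_le (Finset.univ : Finset (Fin k → Fin L)) fun x _ =>
    norm_sum_le_of_le (Finset.univ : Finset (Fin k → Fin L)) fun y _ => hb z x y
  refine hb'.trans ?_
  have hcard : ((permPairs L k).card : ℝ) ≤ (L : ℝ) ^ k * k.factorial := by
    exact_mod_cast card_permPairs_le L k
  simp only [Finset.sum_const, Finset.card_univ, Fintype.card_fun, Fintype.card_fin, nsmul_eq_mul,
    Nat.cast_pow]
  refine (mul_le_mul_of_nonneg_right hcard ?_).trans_eq (by ring)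
  have := opNorm_nonneg Δ
  positivity

theorem norm_bias_le {L k : ℕ} [NeZero L] (ν : Measure (UL L)) [IsFiniteMeasure ν]
    {ρ : FockOp L} (hρ : IsState ρ) {O : FockOp L} (hO : O ∈ corrSpace L k)
    (hO' : O ∈ LinearMap.range (symChannel L)) :
    ‖(ρ * measurementChannel ν (pinv (symChannel L) O)).trace - (ρ * O).trace‖ ≤
      opNorm (momentOp (2 * k) ν - momentOp (2 * k) (symEnsemble L)) *
        (k.factorial * (L : ℝ) ^ (3 * k) * fBound k O) := by
  have hOO : (ρ * O).trace =
      (ρ * measurementChannel (symEnsemble L) (pinv (symChannel L) O)).trace := by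
    obtain ⟨A, rfl⟩ := hO'
    exact congrArg (fun B => (ρ * B).trace) ((pinv_isMoorePenrose (symChannel L)).mul_mul_self A).symm
  rw [hOO, pinv_eq_sum hO, fBound_eq]
  simp only [map_sum, map_smul, Finset.mul_sum, Matrix.trace_sum, mul_smul_comm,
      Matrix.trace_smul, smul_eq_mul, ← Finset.sum_sub_distrib, ← mul_sub]
  refine (norm_sum_le _ _).trans (Finset.sum_le_sum fun s _ => ?_)
  rw [norm_mul, ← mul_assoc, mul_comm]
  exact mul_le_mul_of_nonneg_right (norm_trace_sub_corrOp_le ν _ hρ _ _) (norm_nonneg _)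

/-! ### The extended state -/

/-- Padding occupation numbers with unoccupied modes. -/
def padOcc {L Ltot : ℕ} (n : Occ L) : Occ Ltot :=
  fun i => if h : (i : ℕ) < L then n ⟨i, h⟩ else 0

theorem restrict_padOcc {L Ltot : ℕ} (h : L ≤ Ltot) (n : Occ L) :
    (fun i => (padOcc n : Occ Ltot) (Fin.castLE h i)) = n := by
  funext i
  simp [padOcc]

theorem padOcc_eq_iff {L Ltot : ℕ} (h : L ≤ Ltot) (n : Occ L) (m : Occ Ltot) :
    padOcc n = m ↔ (∀ i : Fin Ltot, L ≤ (i : ℕ) → m i = 0) ∧ n = fun i => m (Fin.castLE h i) := by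
  constructor
  · rintro rfl
    exact ⟨fun i hi => dif_neg hi.not_gt, (restrict_padOcc h n).symm⟩
  · rintro ⟨h1, rfl⟩
    funext i
    by_cases hi : (i : ℕ) < L
    · simp [padOcc, hi]
    · simp [padOcc, hi, h1 i (not_lt.mp hi)]

/-- The isometric embedding of Fock spaces that adds unoccupied modes. -/
def padIsometry (L Ltot : ℕ) : Matrix (Occ Ltot) (Occ L) ℂ :=
  Matrix.of fun m n => if padOcc n = m then 1 else 0

theorem star_padIsometry_apply {L Ltot : ℕ} (m : Occ Ltot) (n : Occ L) :
    star (padIsometry L Ltot m n) = padIsometry L Ltot m n := by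
  rw [padIsometry, Matrix.of_apply]
  split_ifs <;> simp

theorem extendState_eq {L Ltot : ℕ} (h : L ≤ Ltot) (ρ : FockOp L) :
    extendState h ρ = padIsometry L Ltot * ρ * (padIsometry L Ltot)ᴴ := by
  ext m n
  simp only [Matrix.mul_apply, Matrix.conjTranspose_apply, star_padIsometry_apply]
  simp only [extendState, padIsometry, Matrix.of_apply]
  by_cases hm : ∀ i : Fin Ltot, L ≤ (i : ℕ) → m i = 0
  · have em : ∀ x : Occ L, padOcc x = m ↔ x = fun i => m (Fin.castLE h i) := fun x =>
      (padOcc_eq_iff h x m).trans (and_iff_right hm)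
    by_cases hn : ∀ i : Fin Ltot, L ≤ (i : ℕ) → n i = 0
    · have en : ∀ x : Occ L, padOcc x = n ↔ x = fun i => n (Fin.castLE h i) := fun x =>
        (padOcc_eq_iff h x n).trans (and_iff_right hn)
      rw [if_pos ⟨hm, hn⟩]
      simp [em, en]
    · have en : ∀ x : Occ L, padOcc x ≠ n := fun x hx => hn ((padOcc_eq_iff h x n).mp hx).1
      rw [if_neg fun hmn => hn hmn.2]
      simp [en]
  · have em : ∀ x : Occ L, padOcc x ≠ m := fun x hx => hm ((padOcc_eq_iff h x m).mp hx).1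
    rw [if_neg fun hmn => hm hmn.1]
    simp [em]

theorem conjTranspose_padIsometry_mul {L Ltot : ℕ} (h : L ≤ Ltot) :
    (padIsometry L Ltot)ᴴ * padIsometry L Ltot = 1 := by
  ext m n
  simp only [Matrix.mul_apply, Matrix.conjTranspose_apply, star_padIsometry_apply]
  simp only [padIsometry, Matrix.of_apply, Matrix.one_apply]
  have hinj : (padOcc m : Occ Ltot) = padOcc n ↔ m = n := by
    refine ⟨fun e => ?_, fun e => by rw [e]⟩
    rw [← restrict_padOcc h m, ← restrict_padOcc h n, e]
  simp [hinj]

theorem isState_extendState {L Ltot : ℕ} (h : L ≤ Ltot) {ρ : FockOp L} (hρ : IsState ρ) :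
    IsState (extendState h ρ) := by
  refine ⟨?_, ?_⟩
  · rw [extendState_eq]
    exact hρ.posSemidef.mul_mul_conjTranspose_same _
  · rw [extendState_eq, Matrix.trace_mul_cycle, conjTranspose_padIsometry_mul h, one_mul,
      hρ.trace_eq_one]

/-! ### The law of one round -/

theorem continuous_diagEntry {L : ℕ} (A : FockOp L) (n : Occ L) :
    Continuous fun u : UL L => diagEntry u A n :=
  ((continuous_fockUnitary.mul continuous_const).mul
    continuous_fockUnitary.matrix_conjTranspose).matrix_elem n n

theorem diagEntry_nonneg {L : ℕ} {ρ : FockOp L} (hρ : ρ.PosSemidef) (u : UL L) (n : Occ L) :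
    0 ≤ diagEntry u ρ n :=
  (hρ.mul_mul_conjTranspose_same (fockUnitary u)).diag_nonneg

theorem measurable_diagEntry {L : ℕ} (A : FockOp L) :
    Measurable fun z : UL L × Occ L => diagEntry z.1 A z.2 :=
  measurable_from_prod_countable_left fun n => (continuous_diagEntry A n).measurable

theorem integral_roundLaw {L : ℕ} (ν : Measure (UL L)) [IsFiniteMeasure ν] {ρ : FockOp L}
    (hρ : ρ.PosSemidef) (A : FockOp L) :
    ∫ z, diagEntry z.1 A z.2 ∂(roundLaw ν ρ) = ∑ n, ∫ u, diagEntry u ρ n * diagEntry u A n ∂ν := by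
  have hc : ∀ n, Measurable fun u : UL L => (diagEntry u ρ n).re.toNNReal := fun n =>
    (Complex.measurable_re.comp (continuous_diagEntry ρ n).measurable).real_toNNReal
  have hi : ∀ n, Integrable (fun z : UL L × Occ L => diagEntry z.1 A z.2)
      ((ν.withDensity fun u => ENNReal.ofReal (diagEntry u ρ n).re).map fun u => (u, n)) := by
    intro n
    rw [integrable_map_measure (measurable_diagEntry A).aestronglyMeasurable (by fun_prop)]
    refine (integrable_withDensity_iff_integrable_smul (hc n)).mpr ?_
    refine Continuous.integrable_of_hasCompactSupport ?_ (HasCompactSupport.of_compactSpace _)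
    exact (continuous_real_toNNReal.comp
      (Complex.continuous_re.comp (continuous_diagEntry ρ n))).smul (continuous_diagEntry A n)
  rw [roundLaw, integral_finsetSum_measure fun n _ => hi n]
  refine Finset.sum_congr rfl fun n _ => ?_
  rw [integral_map (by fun_prop) (measurable_diagEntry A).aestronglyMeasurable]
  refine (integral_withDensity_eq_integral_smul (hc n) _).trans ?_
  refine integral_congr_ae (Filter.Eventually.of_forall fun u => ?_)
  have h0 := diagEntry_nonneg hρ u n
  have h1 := (Complex.nonneg_iff.mp h0)
  have h2 : ((diagEntry u ρ n).re : ℂ) = diagEntry u ρ n :=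
    Complex.ext (by simp) (by simpa using h1.2)
  change (((diagEntry u ρ n).re.toNNReal : ℝ) : ℂ) * diagEntry u A n = _
  rw [Real.coe_toNNReal _ h1.1, h2]

/-! ### Concentration of complex sample means -/

/-- Hoeffding's inequality for a sum of independent variables with a common mean. -/
theorem measureReal_sum_sub_ge_le {Ω : Type*} [MeasurableSpace Ω] {P : Measure Ω}
    [IsProbabilityMeasure P] {N : ℕ} {X : Fin N → Ω → ℝ} (hX : ∀ m, Measurable (X m))
    (hind : iIndepFun X P) {F : ℝ} (hb : ∀ m ω, |X m ω| ≤ F) {μ : ℝ} (hμ : ∀ m, ∫ ω, X m ω ∂P = μ)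
    {t : ℝ} (ht : 0 ≤ t) :
    P.real {ω | t ≤ ∑ m, X m ω - N * μ} ≤ Real.exp (-t ^ 2 / (2 * (N * F ^ 2))) := by
  have hF : ‖F - -F‖₊ / 2 = ‖F‖₊ := by
    ext
    rw [NNReal.coe_div, coe_nnnorm, coe_nnnorm, sub_neg_eq_add, ← two_mul, norm_mul]
    simp
  have hs : ∀ m ∈ (Finset.univ : Finset (Fin N)),
      HasSubgaussianMGF (fun ω => X m ω - μ) (‖F‖₊ ^ 2) P := fun m _ => by
    have := hasSubgaussianMGF_of_mem_Icc (μ := P) (a := -F) (b := F) (hX m).aemeasurable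
      (Filter.Eventually.of_forall fun ω => abs_le.mp (hb m ω))
    rwa [hF, hμ m] at this
  have hind' : iIndepFun (fun m ω => X m ω - μ) P :=
    hind.comp (fun _ x => x - μ) fun _ => measurable_id.sub_const μ
  have := HasSubgaussianMGF.measure_sum_ge_le_of_iIndepFun hind' hs ht
  simpa [Finset.sum_sub_distrib] using this

theorem measureReal_abs_mean_sub_ge_le {Ω : Type*} [MeasurableSpace Ω] {P : Measure Ω}
    [IsProbabilityMeasure P] {N : ℕ} (hN : 0 < N) {X : Fin N → Ω → ℝ} (hX : ∀ m, Measurable (X m))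
    (hind : iIndepFun X P) {F : ℝ} (hb : ∀ m ω, |X m ω| ≤ F) {μ : ℝ} (hμ : ∀ m, ∫ ω, X m ω ∂P = μ)
    {t : ℝ} (ht : 0 ≤ t) :
    P.real {ω | t ≤ |1 / (N : ℝ) * ∑ m, X m ω - μ|} ≤ 2 * Real.exp (-(N * t ^ 2) / (2 * F ^ 2)) := by
  have hN' : (0 : ℝ) < N := by exact_mod_cast hN
  have h1 := measureReal_sum_sub_ge_le hX hind hb hμ (t := N * t) (by positivity)
  have h2 := measureReal_sum_sub_ge_le (X := fun m ω => -X m ω) (P := P) (F := F) (μ := -μ)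
    (fun m => (hX m).neg) (hind.comp (fun _ x => -x) fun _ => measurable_neg)
    (fun m ω => by simpa using hb m ω) (fun m => by rw [integral_neg, hμ m])
    (t := N * t) (by positivity)
  have e : -(N * t) ^ 2 / (2 * (N * F ^ 2)) = -(N * t ^ 2) / (2 * F ^ 2) := by
    rw [show -(N * t) ^ 2 = N * -(N * t ^ 2) by ring,
      show 2 * (N * F ^ 2) = N * (2 * F ^ 2) by ring, mul_div_mul_left _ _ hN'.ne']
  rw [e] at h1 h2
  rw [two_mul]
  refine le_trans (measureReal_mono ?_) ((measureReal_union_le _ _).trans (add_le_add h1 h2))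
  intro ω hω
  have hω : t ≤ |1 / (N : ℝ) * ∑ m, X m ω - μ| := hω
  have e2 : ∑ m, X m ω - N * μ = N * (1 / (N : ℝ) * ∑ m, X m ω - μ) := by field_simp
  rcases le_abs.mp hω with h | h
  · left
    change N * t ≤ _
    rw [e2]
    exact mul_le_mul_of_nonneg_left h hN'.le
  · right
    change N * t ≤ ∑ m, -X m ω - N * -μ
    rw [Finset.sum_neg_distrib, show -∑ m, X m ω - N * -μ = -(∑ m, X m ω - N * μ) by ring, e2,
      ← mul_neg]
    exact mul_le_mul_of_nonneg_left h hN'.le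

theorem measureReal_norm_mean_sub_ge_le {Ω : Type*} [MeasurableSpace Ω] {P : Measure Ω}
    [IsProbabilityMeasure P] {N : ℕ} (hN : 0 < N) {X : Fin N → Ω → ℂ} (hX : ∀ m, Measurable (X m))
    (hind : iIndepFun X P) {F : ℝ} (hb : ∀ m ω, ‖X m ω‖ ≤ F) {μ : ℂ} (hμ : ∀ m, ∫ ω, X m ω ∂P = μ)
    {ε : ℝ} (hε : 0 ≤ ε) :
    P.real {ω | ε ≤ ‖1 / (N : ℂ) * ∑ m, X m ω - μ‖} ≤
      4 * Real.exp (-(N * ε ^ 2) / (4 * F ^ 2)) := by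
  have hi : ∀ m, Integrable (X m) P := fun m =>
    (integrable_const F).mono' (hX m).aestronglyMeasurable (Filter.Eventually.of_forall (hb m))
  have h1 := measureReal_abs_mean_sub_ge_le hN (X := fun m ω => (X m ω).re) (P := P) (F := F)
    (μ := μ.re) (fun m => Complex.measurable_re.comp (hX m))
    (hind.comp (fun _ x => x.re) fun _ => Complex.measurable_re)
    (fun m ω => (Complex.abs_re_le_norm _).trans (hb m ω))
    (fun m => by rw [← hμ m]; exact integral_re (hi m)) (t := ε / √2) (by positivity)
  have h2 := measureReal_abs_mean_sub_ge_le hN (X := fun m ω => (X m ω).im) (P := P) (F := F)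
    (μ := μ.im) (fun m => Complex.measurable_im.comp (hX m))
    (hind.comp (fun _ x => x.im) fun _ => Complex.measurable_im)
    (fun m ω => (Complex.abs_im_le_norm _).trans (hb m ω))
    (fun m => by rw [← hμ m]; exact integral_im (hi m)) (t := ε / √2) (by positivity)
  have hs : (ε / √2) ^ 2 = ε ^ 2 / 2 := by rw [div_pow, Real.sq_sqrt zero_le_two]
  have e : -(N * (ε / √2) ^ 2) / (2 * F ^ 2) = -(N * ε ^ 2) / (4 * F ^ 2) := by
    rw [hs, show -(N * (ε ^ 2 / 2)) = -(N * ε ^ 2) / 2 by ring, div_div]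
    ring_nf
  rw [e] at h1 h2
  rw [show (4 : ℝ) = 2 + 2 by norm_num, add_mul, show (2 : ℝ) + 2 = 4 by norm_num]
  refine le_trans (measureReal_mono ?_) ((measureReal_union_le _ _).trans (add_le_add h1 h2))
  intro ω hω
  by_contra hcon
  simp only [Set.mem_union, Set.mem_ofPred_eq, not_or, not_le] at hcon
  have hω : ε ≤ ‖1 / (N : ℂ) * ∑ m, X m ω - μ‖ := hω
  set z := 1 / (N : ℂ) * ∑ m, X m ω - μ
  have hre : z.re = 1 / (N : ℝ) * ∑ m, (X m ω).re - μ.re := by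
    simp [z, ← Complex.ofReal_natCast, ← Complex.ofReal_inv]
  have him : z.im = 1 / (N : ℝ) * ∑ m, (X m ω).im - μ.im := by
    simp [z, ← Complex.ofReal_natCast, ← Complex.ofReal_inv]
  rw [← hre, ← him] at hcon
  have h3 := pow_lt_pow_left₀ hcon.1 (abs_nonneg _) two_ne_zero
  have h4 := pow_lt_pow_left₀ hcon.2 (abs_nonneg _) two_ne_zero
  rw [sq_abs, hs] at h3 h4
  have h5 : ‖z‖ ^ 2 = z.re ^ 2 + z.im ^ 2 := by
    rw [Complex.sq_norm, Complex.normSq_apply, sq, sq]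
  have h6 := pow_le_pow_left₀ hε hω 2
  linarith

/-! ### The estimator -/

theorem measurable_singleShot {L : ℕ} [NeZero L] (O : FockOp L) :
    Measurable (singleShot O) := measurable_diagEntry _

theorem integral_singleShot {L : ℕ} [NeZero L] (ν : Measure (UL L)) [IsFiniteMeasure ν]
    {ρ : FockOp L} (hρ : ρ.PosSemidef) (O : FockOp L) :
    ∫ z, singleShot O z ∂(roundLaw ν ρ) =
      (ρ * measurementChannel ν (pinv (symChannel L) O)).trace := by
  refine (integral_roundLaw ν hρ _).trans ?_
  rw [trace_mul_measurementChannel]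
  simp only [trace_mul_channelIntegrand]
  refine (integral_finsetSum _ fun n _ => ?_).symm
  exact ((continuous_diagEntry ρ n).mul (continuous_diagEntry _ n)).integrable_of_hasCompactSupport
    (HasCompactSupport.of_compactSpace _)

/-- The probability that the sample mean deviates from its expectation by at least `ε`. -/
theorem measureReal_meanEstimate_sub_ge_le {L k : ℕ} [NeZero L] {N : ℕ} (hN : 0 < N)
    {ν : Measure (UL L)} [IsFiniteMeasure ν] {ρ : FockOp L} (hρ : ρ.PosSemidef)
    {Ω : Type*} [MeasurableSpace Ω] {P : Measure Ω} [IsProbabilityMeasure P]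
    {Z : Fin N → Ω → UL L × Occ L} (hZ : ∀ m, Measurable (Z m)) (hind : iIndepFun Z P)
    (hlaw : ∀ m, P.map (Z m) = roundLaw ν ρ) {O : FockOp L} (hO : O ∈ corrSpace L k) {F : ℝ}
    (hF : fBound k O ≤ F) {ε : ℝ} (hε : 0 ≤ ε) :
    P.real {ω | ε ≤ ‖meanEstimate O (fun m => Z m ω) -
      (ρ * measurementChannel ν (pinv (symChannel L) O)).trace‖} ≤
      4 * Real.exp (-(N * ε ^ 2) / (4 * F ^ 2)) := by
  refine measureReal_norm_mean_sub_ge_le hN (X := fun m ω => singleShot O (Z m ω))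
    (fun m => (measurable_singleShot O).comp (hZ m))
    (hind.comp (fun _ => singleShot O) fun _ => measurable_singleShot O)
    (fun m ω => (norm_singleShot_le hO _).trans hF) (fun m => ?_) hε
  rw [← integral_singleShot ν hρ, ← hlaw m,
    integral_map (hZ m).aemeasurable (measurable_singleShot O).aestronglyMeasurable]

theorem card_mul_exp_le {M N F ε δ : ℝ} (hM : 0 < M) (hF : 0 < F) (hε : 0 < ε) (hδ : 0 < δ)
    (hN : 4 / ε ^ 2 * Real.log (4 * M / δ) * F ^ 2 ≤ N) :
    M * (4 * Real.exp (-(N * ε ^ 2) / (4 * F ^ 2))) ≤ δ := by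
  have h1 : -(N * ε ^ 2) / (4 * F ^ 2) ≤ -Real.log (4 * M / δ) := by
    rw [neg_div, neg_le_neg_iff, le_div_iff₀ (by positivity)]
    have := mul_le_mul_of_nonneg_right hN (sq_nonneg ε)
    refine le_trans (le_of_eq ?_) this
    field_simp
  have h2 := Real.exp_le_exp.mpr h1
  rw [Real.exp_neg, Real.exp_log (by positivity), inv_div] at h2
  refine (mul_le_mul_of_nonneg_left (mul_le_mul_of_nonneg_left h2 zero_le_four) hM.le).trans
    (le_of_eq ?_)
  field_simp

end FermiShadow

end

theorem mainTheorem10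
    -- `L` system modes, embedded into `Ltot ≥ L` modes, in the state `ρ`
    (L Ltot k : ℕ) [NeZero Ltot] (hL : L ≤ Ltot)
    (ρ : FermiShadow.FockOp L) (hρ : FermiShadow.IsState ρ)
    -- the correlation functions to be estimated, and the operators used to estimate them
    (I : Finset ((Fin k → Fin L) × (Fin k → Fin L))) (hI : I.Nonempty)
    (O : (Fin k → Fin L) × (Fin k → Fin L) → FermiShadow.FockOp Ltot)
    (hO : ∀ p ∈ I, FermiShadow.IsRecoveryOp hL ρ p.1 p.2 (O p))
    (ε ε' δ : ℝ) (hε : 0 < ε) (hε' : 0 < ε') (hδ : 0 < δ)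
    -- the number of rounds
    (N : ℕ)
    (hN : 4 / ε ^ 2 * Real.log (4 * (I.card : ℝ) / δ) *
        (I.sup' hI fun p => FermiShadow.fBound k (O p)) ^ 2 ≤ (N : ℝ))
    (ν : MeasureTheory.Measure (FermiShadow.UL Ltot)) [MeasureTheory.IsProbabilityMeasure ν]
    (hν : FermiShadow.opNorm (FermiShadow.momentOp (2 * k) ν -
          FermiShadow.momentOp (2 * k) (FermiShadow.symEnsemble Ltot)) *
        ((k.factorial : ℝ) * (Ltot : ℝ) ^ (3 * k) *
          I.sup' hI fun p => FermiShadow.fBound k (O p)) ≤ ε')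
    -- `N` independent rounds, with data `Z m = (u^(m), n^(m))`
    {Ω : Type*} [MeasurableSpace Ω] (P : MeasureTheory.Measure Ω)
    [MeasureTheory.IsProbabilityMeasure P]
    (Z : Fin N → Ω → FermiShadow.UL Ltot × FermiShadow.Occ Ltot)
    (hZ : ∀ m, Measurable (Z m)) (hind : ProbabilityTheory.iIndepFun Z P)
    (hlaw : ∀ m, P.map (Z m) = FermiShadow.roundLaw ν (FermiShadow.extendState hL ρ)) :
    1 - δ ≤ P.real {ω | (I.sup' hI fun p =>
      ‖FermiShadow.meanEstimate (O p) (fun m => Z m ω) -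
        (ρ * FermiShadow.corrOp p.1 p.2).trace‖) < ε + ε'}
 := by
  classical
  set F : ℝ := I.sup' hI fun p => FermiShadow.fBound k (O p)
  have hFp : ∀ p ∈ I, FermiShadow.fBound k (O p) ≤ F := fun p hp =>
    Finset.le_sup' (fun p => FermiShadow.fBound k (O p)) hp
  have hcard : 0 < I.card := hI.card_pos
  have hρ' := FermiShadow.isState_extendState hL hρ
  set ρ' := FermiShadow.extendState hL ρ
  set E : (Fin k → Fin L) × (Fin k → Fin L) → ℂ := fun p =>
    (ρ' * FermiShadow.measurementChannel ν (FermiShadow.pinv (FermiShadow.symChannel Ltot)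
      (O p))).trace
  have hbias : ∀ p ∈ I, ‖E p - (ρ * FermiShadow.corrOp p.1 p.2).trace‖ ≤ ε' := fun p hp => by
    have h := FermiShadow.norm_bias_le ν hρ' (hO p hp).mem_corrSpace (hO p hp).mem_range
    rw [(hO p hp).trace_eq] at h
    refine h.trans (le_trans ?_ hν)
    exact mul_le_mul_of_nonneg_left (mul_le_mul_of_nonneg_left (hFp p hp) (by positivity))
      (FermiShadow.opNorm_nonneg _)
  set bad : (Fin k → Fin L) × (Fin k → Fin L) → Set Ω := fun p =>
    {ω | ε ≤ ‖FermiShadow.meanEstimate (O p) (fun m => Z m ω) - E p‖} with hbad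
  have hsub : (⋃ p ∈ I, bad p)ᶜ ⊆ {ω | (I.sup' hI fun p =>
      ‖FermiShadow.meanEstimate (O p) (fun m => Z m ω) -
        (ρ * FermiShadow.corrOp p.1 p.2).trace‖) < ε + ε'} := by
    intro ω hω
    rw [Set.mem_ofPred_eq, Finset.sup'_lt_iff]
    intro p hp
    have h1 : ω ∉ bad p := fun h => hω (Set.mem_biUnion hp h)
    have h2 : ‖FermiShadow.meanEstimate (O p) (fun m => Z m ω) - E p‖ < ε := not_le.mp h1
    exact (norm_sub_le_norm_sub_add_norm_sub _ (E p) _).trans_lt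
      (add_lt_add_of_lt_of_le h2 (hbias p hp))
  have hmeas : MeasurableSet (⋃ p ∈ I, bad p) := by
    refine Finset.measurableSet_biUnion I fun p _ => measurableSet_le measurable_const ?_
    refine Measurable.norm (Measurable.sub_const (Measurable.const_mul ?_ _) _)
    exact Finset.measurable_fun_sum _ fun m _ =>
      (FermiShadow.measurable_singleShot (O p)).comp (hZ m)
  suffices h : P.real (⋃ p ∈ I, bad p) ≤ δ by
    refine le_trans ?_ (MeasureTheory.measureReal_mono hsub)
    rw [MeasureTheory.probReal_compl_eq_one_sub hmeas]
    linarith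
  rcases le_or_gt (4 * (I.card : ℝ)) δ with hδ4 | hδ4
  · have : (1 : ℝ) ≤ I.card := by exact_mod_cast hcard
    exact MeasureTheory.measureReal_le_one.trans (by linarith)
  have hF0 : 0 ≤ F := by
    obtain ⟨p, hp⟩ := hI
    exact (FermiShadow.fBound_nonneg k (O p)).trans (hFp p hp)
  rcases hF0.eq_or_lt with hF0 | hF0
  · have hempty : ∀ p ∈ I, bad p = ∅ := fun p hp => by
      have hf : FermiShadow.fBound k (O p) = 0 :=
        le_antisymm ((hFp p hp).trans hF0.ge) (FermiShadow.fBound_nonneg _ _)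
      have hX : ∀ z, FermiShadow.singleShot (O p) z = 0 := fun z => norm_le_zero_iff.mp
        ((FermiShadow.norm_singleShot_le (hO p hp).mem_corrSpace z).trans hf.le)
      have hEp : E p = 0 := by
        have := FermiShadow.integral_singleShot ν hρ'.posSemidef (O p)
        simp only [hX, MeasureTheory.integral_zero] at this
        exact this.symm
      ext ω
      simp [hbad, hEp, FermiShadow.meanEstimate, hX, hε]
    rw [Set.iUnion₂_congr hempty]
    simpa using hδ.le
  · have hlog : 0 < Real.log (4 * (I.card : ℝ) / δ) := Real.log_pos ((one_lt_div hδ).mpr hδ4)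
    have hN0 : 0 < N := by
      have : (0 : ℝ) < N := lt_of_lt_of_le (by positivity) hN
      exact_mod_cast this
    refine (MeasureTheory.measureReal_biUnion_finset_le I bad).trans ?_
    refine (Finset.sum_le_card_nsmul I _ _ fun p hp =>
      FermiShadow.measureReal_meanEstimate_sub_ge_le hN0 hρ'.posSemidef hZ hind hlaw
        (hO p hp).mem_corrSpace (hFp p hp) hε.le).trans ?_
    rw [nsmul_eq_mul]
    exact FermiShadow.card_mul_exp_le (by exact_mod_cast hcard) hF0 hε hδ hN
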